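/- Let $u$ be a scalar and $U=(U_1,\dots,U_N)$ a vector unknown, with $\langle \partial_x^mU,\partial_x^nU\rangle=\sum_{j}(\partial_x^mU_j)(\partial_x^nU_j)$. We consider evolutionary systems $u_t=F$, $U_t=G$, where $F$ is a polynomial in the derivatives $\partial_x^m u$ and the scalar products $\langle\partial_x^mU,\partial_x^nU\rangle$, and $G=\sum_k P_k\,\partial_x^kU$ with $P_k$ polynomials of the same kind; the coefficients are complex constants that do not depend on $N$, and $N\ge 1$ is arbitrary. Give $u,U,\partial_x$ the weights $\frac23,\frac13,1$. For $r\ge 1$, an *$r$-th order symmetry* of such a system is a system $u_\tau=H$, $U_\tau=K$ of the same kind with $H\ne0$ homogeneous of weight $\frac23+r$ and $K\neq 0$ homogeneous of weight $\frac13+r$, in which some $x$-derivative of order $r$ of $u$ or $U$ occurs, and which satisfies $u_{t\tau}=u_{\tau t}$ and $U_{t\tau}=U_{\tau t}$ identically for every $N\ge1$. Consider the second order systems $$\begin{aligned}u_{t}&=a_1u_{xx}+a_2u^4+a_3\langle U,U_{xx}\rangle+a_4\langle U_x,U_x\rangle+a_5u^3\langle U,U\rangle+a_6u^2\langle U,U\rangle^2+a_7u\langle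 U,U\rangle^3+a_8\langle U,U\rangle^4,\\ U_{t}&=a_9U_{xx}+a_{10}u^3U+a_{11}u^2\langle U,U\rangle U+a_{12}u\langle U,U\rangle^2U+a_{13}\langle U,U\rangle^3U,\end{aligned}\tag{S}$$ with $a_1,\dots,a_{13}\in\mathbb C$, $(a_1,a_3,a_9)\ne 0$, $(a_3,a_4,a_5,a_6,a_7,a_8)\neq 0$ and $(a_{10},a_{11},a_{12})\ne 0$. **Theorem.** Every system (S) with a 4th order symmetry coincides, up to a scaling of $t,x,u,U$ (that is, a substitution $u(x,t)=\alpha\tilde u(\xi x,\tau t)$, $U(x,t)=\beta\tilde U(\xi x,\tau t)$ with non-zero complex constants $\alpha,\beta,\xi,\tau$), with one of the two systems $$\begin{aligned}u_t&=u_{xx}+2\langle U,U_{xx}\rangle+2\langle U_x,U_x\rangle+2u\langle U,U\rangle^3+2\langle U,U\rangle^4,\\ U_t&=-u\langle U,U\rangle^2U-\langle U,U\rangle^3U,\end{aligned}\tag{1}$$ $$\begin{aligned}u_t&=-2\langle U,U_{xx}\rangle-2u^3\langle U,U\rangle-6u^2\langle U,U\rangle^2-6u\langle U,U\rangle^3-2\langle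 U,U\rangle^4,\\ U_t&=U_{xx}+u^3U+3u^2\langle U,U\rangle U+3u\langle U,U\rangle^2U+\langle U,U\rangle^3U.\end{aligned}\tag{2}$$ Moreover, (1) and (2) both have a 4th order symmetry, and (2) has no 3rd order symmetry. -/

import Mathlib

namespace VectorEvolution

open MvPolynomial

noncomputable section

/-! ### Right-hand sides of systems for one scalar `u` and one vector `U` of unspecified length -/

/-- The scalar factors from which right-hand sides are built: the derivative `∂ₓᵐ u`, and the scalar
product `⟨∂ₓᵐ U, ∂ₓⁿ U⟩`, labelled by the unordered pair `s(m, n)`. -/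
inductive Factor : Type
  | u (m : ℕ) : Factor
  | dot (p : Sym2 ℕ) : Factor

/-- Polynomials in the derivatives of `u` and the scalar products of the derivatives of `U`. -/
abbrev ScalarExpr : Type := MvPolynomial Factor ℂ

/-- Vector expressions `∑ₖ Pₖ ∂ₓᵏ U`; the coefficient `Pₖ` is the value at `k`. -/
abbrev VectorExpr : Type := ℕ →₀ ScalarExpr

/-- An evolutionary system `u_t = scalar`, `U_t = vector`, with constant coefficients that do not
depend on the number of components of `U`. -/
@[ext]
structure EvSystem : Type where
  scalar : ScalarExpr
  vector : VectorExpr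

/-- `∂ₓᵐ u`. -/
def du (m : ℕ) : ScalarExpr := X (Factor.u m)

/-- `⟨∂ₓᵐ U, ∂ₓⁿ U⟩`. -/
def dotU (m n : ℕ) : ScalarExpr := X (Factor.dot s(m, n))

/-- `P ∂ₓᵏ U`. -/
def smulU (P : ScalarExpr) (k : ℕ) : VectorExpr := Finsupp.single k P

/-! ### The system for a vector `U = (U₁, …, U_N)` -/

/-- Differential polynomials in `u, U₁, …, U_N`: the variable `(none, m)` is `∂ₓᵐ u` and the
variable `(some j, m)` is `∂ₓᵐ Uⱼ`. -/
abbrev DiffPoly (N : ℕ) : Type := MvPolynomial (Option (Fin N) × ℕ) ℂ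

/-- The total derivative with respect to `x`. -/
def Dx (N : ℕ) : Derivation ℂ (DiffPoly N) (DiffPoly N) :=
  mkDerivation ℂ fun v => X (v.1, v.2 + 1)

/-- The derivative with respect to the time of the flow `w_t = F w`, where `w` runs through
`u, U₁, …, U_N`: the derivation that sends `∂ₓᵐ w` to `Dₓᵐ (F w)`. -/
def Dt {N : ℕ} (F : Option (Fin N) → DiffPoly N) : Derivation ℂ (DiffPoly N) (DiffPoly N) :=
  mkDerivation ℂ fun v => (Dx N)^[v.2] (F v.1)

/-- `⟨∂ₓᵐ U, ∂ₓⁿ U⟩ = ∑ⱼ ∂ₓᵐ Uⱼ ∂ₓⁿ Uⱼ`. -/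
def dotComponents (N : ℕ) (p : Sym2 ℕ) : DiffPoly N :=
  Sym2.lift ⟨fun m n => ∑ j : Fin N, (X (some j, m) * X (some j, n) : DiffPoly N),
    fun _ _ => Finset.sum_congr rfl fun _ _ => mul_comm _ _⟩ p

/-- A scalar factor written in the components of `U`. -/
def Factor.toComponents (N : ℕ) : Factor → DiffPoly N
  | .u m => X (none, m)
  | .dot p => dotComponents N p

/-- A scalar expression written in the components of `U`. -/
def ScalarExpr.toComponents (N : ℕ) (P : ScalarExpr) : DiffPoly N :=
  aeval (Factor.toComponents N) P

/-- The right-hand sides of the equations for `u` and for `U₁, …, U_N`. -/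
def EvSystem.rhs (S : EvSystem) (N : ℕ) : Option (Fin N) → DiffPoly N
  | none => ScalarExpr.toComponents N S.scalar
  | some j => S.vector.sum fun k P => ScalarExpr.toComponents N P * X (some j, k)

/-- The flows of `S` (time `t`) and `T` (time `τ`) commute for vectors `U` with `N` components:
`u_{tτ} = u_{τt}` and `U_{tτ} = U_{τt}`. -/
def EvSystem.CommutesWith (S T : EvSystem) (N : ℕ) : Prop :=
  ∀ w : Option (Fin N), Dt (T.rhs N) (S.rhs N w) = Dt (S.rhs N) (T.rhs N w)

/-! ### Weights and orders -/

/-- The weight of a factor when `u`, `U`, `∂ₓ` have the weights `l₁`, `l₂`, `1`. -/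
def Factor.weight (l₁ l₂ : ℚ) : Factor → ℚ
  | .u m => l₁ + m
  | .dot p => Sym2.lift ⟨fun m n : ℕ => (l₂ + m) + (l₂ + n), fun _ _ => add_comm _ _⟩ p

/-- The highest order of an `x`-derivative in a factor. -/
def Factor.order : Factor → ℕ
  | .u m => m
  | .dot p => Sym2.lift ⟨fun m n : ℕ => max m n, fun _ _ => max_comm _ _⟩ p

/-- `S` is `(l₁, l₂)`-homogeneous of weight `μ`: the right-hand side of the scalar equation has
weight `l₁ + μ` and that of the vector equation has weight `l₂ + μ`, so that the coefficient of
`∂ₓᵏ U`, which itself has weight `l₂ + k`, has weight `μ - k`. -/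
def EvSystem.IsHomogeneous (S : EvSystem) (l₁ l₂ μ : ℚ) : Prop :=
  IsWeightedHomogeneous (Factor.weight l₁ l₂) S.scalar (l₁ + μ) ∧
    ∀ k : ℕ, IsWeightedHomogeneous (Factor.weight l₁ l₂) (S.vector k) (μ - k)

/-- An `x`-derivative of order `r` of `u` or `U` occurs in a right-hand side of `S`. -/
def EvSystem.InvolvesOrder (S : EvSystem) (r : ℕ) : Prop :=
  (∃ f ∈ S.scalar.vars, f.order = r) ∨ S.vector r ≠ 0 ∨
    ∃ k : ℕ, ∃ f ∈ (S.vector k).vars, f.order = r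

/-- `T` is an `r`-th order symmetry of `S` in the weighting `(2/3, 1/3)`: it is homogeneous of
weight `r`, of order `r`, both of its right-hand sides are non-zero, and its flow commutes with that
of `S` for every number `N ≥ 1` of components of `U`. -/
structure EvSystem.IsSymmetry (S T : EvSystem) (r : ℕ) : Prop where
  homogeneous : T.IsHomogeneous (2 / 3) (1 / 3) r
  order : T.InvolvesOrder r
  scalar_ne_zero : T.scalar ≠ 0
  vector_ne_zero : T.vector ≠ 0
  commutes : ∀ N : ℕ, 1 ≤ N → S.CommutesWith T N

/-- `S` has an `r`-th order symmetry. -/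
def EvSystem.HasSymmetry (S : EvSystem) (r : ℕ) : Prop := ∃ T : EvSystem, S.IsSymmetry T r

/-! ### Scalings -/

/-- The constant by which a factor is multiplied when `∂ₓ`, `u`, `U` are multiplied by
`ξ`, `α`, `β`. -/
def Factor.scale (ξ α β : ℂ) : Factor → ℂ
  | .u m => α * ξ ^ m
  | .dot p => Sym2.lift ⟨fun m n : ℕ => (β * ξ ^ m) * (β * ξ ^ n), fun _ _ => mul_comm _ _⟩ p

/-- The substitution `∂ₓᵐ u ↦ α ξᵐ ∂ₓᵐ u`, `∂ₓᵐ U ↦ β ξᵐ ∂ₓᵐ U` in a scalar expression. -/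
def ScalarExpr.scale (ξ α β : ℂ) (P : ScalarExpr) : ScalarExpr :=
  aeval (fun f => C (f.scale ξ α β) * X f) P

/-- `S` turns into `T` by a scaling of `t, x, u, U`, that is, by the substitution
`u(x, t) = α ũ(ξ x, τ t)`, `U(x, t) = β Ũ(ξ x, τ t)` with non-zero constants. The left-hand sides
`u_t`, `U_t` are then `α τ ũ_t`, `β τ Ũ_t`. -/
def EvSystem.ScalesTo (S T : EvSystem) : Prop :=
  ∃ τ ξ α β : ℂ, τ ≠ 0 ∧ ξ ≠ 0 ∧ α ≠ 0 ∧ β ≠ 0 ∧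
    C (α * τ) * T.scalar = ScalarExpr.scale ξ α β S.scalar ∧
    ∀ k : ℕ, C (β * τ) * T.vector k = ScalarExpr.scale ξ α β (S.vector k) * C (β * ξ ^ k)

/-! ### The second order systems in the weighting `(2/3, 1/3)` -/

/-- The coefficients of the general second order system. -/
structure Coeffs : Type where
  (a₁ a₂ a₃ a₄ a₅ a₆ a₇ a₈ a₉ a₁₀ a₁₁ a₁₂ a₁₃ : ℂ)

/-- The general second order system that is homogeneous in the weighting `(2/3, 1/3)`. -/
def Coeffs.system (a : Coeffs) : EvSystem where
  scalar := C a.a₁ * du 2 + C a.a₂ * du 0 ^ 4 + C a.a₃ * dotU 0 2 + C a.a₄ * dotU 1 1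
    + C a.a₅ * du 0 ^ 3 * dotU 0 0 + C a.a₆ * du 0 ^ 2 * dotU 0 0 ^ 2
    + C a.a₇ * du 0 * dotU 0 0 ^ 3 + C a.a₈ * dotU 0 0 ^ 4
  vector := smulU (C a.a₉) 2
    + smulU (C a.a₁₀ * du 0 ^ 3 + C a.a₁₁ * du 0 ^ 2 * dotU 0 0
      + C a.a₁₂ * du 0 * dotU 0 0 ^ 2 + C a.a₁₃ * dotU 0 0 ^ 3) 0

/-- The order is two, `U` occurs in the equation for `u`, and `u` occurs in the equation
for `U`. -/
structure Coeffs.IsAdmissible (a : Coeffs) : Prop where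
  order_two : a.a₁ ≠ 0 ∨ a.a₃ ≠ 0 ∨ a.a₉ ≠ 0
  scalar_coupled : a.a₃ ≠ 0 ∨ a.a₄ ≠ 0 ∨ a.a₅ ≠ 0 ∨ a.a₆ ≠ 0 ∨ a.a₇ ≠ 0 ∨ a.a₈ ≠ 0
  vector_coupled : a.a₁₀ ≠ 0 ∨ a.a₁₁ ≠ 0 ∨ a.a₁₂ ≠ 0

/-- `u_t = u_xx + 2⟨U,U_xx⟩ + 2⟨U_x,U_x⟩ + 2u⟨U,U⟩³ + 2⟨U,U⟩⁴`,
`U_t = -u⟨U,U⟩²U - ⟨U,U⟩³U`. -/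
def systemOne : EvSystem where
  scalar := du 2 + 2 * dotU 0 2 + 2 * dotU 1 1 + 2 * du 0 * dotU 0 0 ^ 3 + 2 * dotU 0 0 ^ 4
  vector := smulU (-(du 0 * dotU 0 0 ^ 2) - dotU 0 0 ^ 3) 0

/-- `u_t = -2⟨U,U_xx⟩ - 2u³⟨U,U⟩ - 6u²⟨U,U⟩² - 6u⟨U,U⟩³ - 2⟨U,U⟩⁴`,
`U_t = U_xx + u³U + 3u²⟨U,U⟩U + 3u⟨U,U⟩²U + ⟨U,U⟩³U`. -/
def systemTwo : EvSystem where
  scalar := -(2 * dotU 0 2) - 2 * du 0 ^ 3 * dotU 0 0 - 6 * du 0 ^ 2 * dotU 0 0 ^ 2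
    - 6 * du 0 * dotU 0 0 ^ 3 - 2 * dotU 0 0 ^ 4
  vector := smulU 1 2
    + smulU (du 0 ^ 3 + 3 * du 0 ^ 2 * dotU 0 0 + 3 * du 0 * dotU 0 0 ^ 2 + dotU 0 0 ^ 3) 0

end

end VectorEvolution

namespace VectorEvolution

open MvPolynomial

/-! ### Polynomials as lists of terms -/

/-! A symmetry is homogeneous, hence a combination of finitely many monomials with unknown constant
coefficients. As `N` grows the scalar products become algebraically independent
(`exists_components`, `eq_zero_of_toComponents_eq_zero`), so commutation for all `N` forces every
coefficient of the formal commutator to vanish. This gives equations that are bilinear in the `aᵢ`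
and the unknowns.

By weight, order four means that the coefficient of `∂ₓ⁴u` or `⟨U, ∂ₓ⁴U⟩` in the scalar equation, or
of `∂ₓ⁴U` in the vector equation, is non-zero (`leading_ne_zero`). A modest selection of the
equations then decides everything. If `a₉ ≠ 0`, all `aᵢ` are expressed through `a₉`, `a₁₀` and one
constant `l` (`diffusive_coeffs`). If `a₉ = 0 ≠ a₁`, they are expressed through `a₁`, `a₁₂` and `l`
(`nondiffusive_leading`, `nondiffusive_coeffs`). The case `a₁ = a₉ = 0` is impossible
(`diagonal_ne_zero`). Since `l = 0` would remove `U` from the equation for `u`, a scaling normalises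
the constants and produces (2) or (1).

Conversely, put `w = u + ⟨U, U⟩`. System (1) reads `w_t = w_xx`, `U_t = -w⟨U, U⟩²U` and commutes
with `w_τ = w_xxxx`, `U_τ = -⟨U, U⟩²w_xx U`. System (2) reads `w_t = 0`, `U_t = LU` with `L = ∂ₓ² +
w³`. As `w` is conserved, `L` commutes with the time derivative, and `w_τ = 0`, `U_τ = L²U` is a
symmetry. For order three, five coefficients of the commutator already annihilate all possible
leading coefficients.

The commutators are computed on lists of terms whose coefficients are integers times products of
parameters. Only the selected coefficients are extracted and confirmed by kernel evaluation; what
remains is elimination over `ℂ`. -/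

/-- The scalar factors, with the scalar product `⟨∂ₓᵐ U, ∂ₓᵐ⁺ᵉ U⟩` written as `dot m e`. -/
inductive Atom : Type
  | u (m : ℕ) : Atom
  | dot (m e : ℕ) : Atom
  deriving DecidableEq

namespace Atom

/-- Equality of atoms as a Boolean that reduces well in the kernel. -/
def beq : Atom → Atom → Bool
  | u m, u n => Nat.beq m n
  | dot m e, dot n f => Nat.beq m n && Nat.beq e f
  | _, _ => false

instance : BEq Atom := ⟨beq⟩

instance : LawfulBEq Atom where
  rfl {a} := by cases a <;> simp [BEq.beq, beq]
  eq_of_beq {a b} h := by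
    cases a <;> cases b <;> simp_all [BEq.beq, beq]

/-- The factor that an atom stands for. -/
def toFactor : Atom → Factor
  | u m => .u m
  | dot m e => .dot s(m, m + e)

theorem toFactor_injective : Function.Injective toFactor := by
  intro a b h
  cases a <;> cases b <;> simp_all [toFactor]
  omega

/-- The atom for `⟨∂ₓᵐ U, ∂ₓⁿ U⟩`. -/
def inner (m n : ℕ) : Atom := bif Nat.ble m n then dot m (n - m) else dot n (m - n)

theorem toFactor_inner (m n : ℕ) : (inner m n).toFactor = .dot s(m, n) := by
  by_cases h : m ≤ n
  · simp [inner, Nat.ble_eq_true_of_le h, toFactor, Nat.add_sub_cancel' h]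
  · have : Nat.ble m n = false := Bool.eq_false_iff.2 fun e => h (Nat.le_of_ble_eq_true e)
    simp [inner, this, toFactor, Nat.add_sub_cancel' (le_of_not_ge h), Sym2.eq_swap]

end Atom

/-- A term: an integer coefficient, the indices of the parameters that it is multiplied by, and the
atoms of its monomial. -/
structure Term : Type where
  coeff : ℤ
  params : List ℕ
  mono : List Atom

/-- Scalar expressions as lists of terms. -/
abbrev Poly : Type := List Term

/-- Vector expressions as lists of terms `P ∂ₓᵏ U`. -/
abbrev VPoly : Type := List (Term × ℕ)

section Eval

variable {R : Type*} [CommRing R] [Algebra ℂ R] (ρ : ℕ → ℂ) (g : Atom → R)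

/-- The constant factor of a term. -/
def Term.const (t : Term) : ℂ := t.coeff * (t.params.map ρ).prod

/-- The value of a term. -/
def Term.eval (t : Term) : R := algebraMap ℂ R (t.const ρ) * (t.mono.map g).prod

/-- The value of a polynomial. -/
def Poly.eval (p : Poly) : R := (p.map (Term.eval ρ g)).sum

/-- The value of a vector polynomial, where `∂ₓᵏ U` takes the value `z k`. -/
def VPoly.eval (z : ℕ → R) (p : VPoly) : R := (p.map fun t => t.1.eval ρ g * z t.2).sum

@[simp] theorem Poly.eval_nil : Poly.eval ρ g [] = 0 := rfl

@[simp] theorem Poly.eval_cons (t : Term) (p : Poly) :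
    Poly.eval ρ g (t :: p) = t.eval ρ g + Poly.eval ρ g p := by simp [Poly.eval]

@[simp] theorem Poly.eval_append (p q : Poly) :
    Poly.eval ρ g (p ++ q) = Poly.eval ρ g p + Poly.eval ρ g q := by simp [Poly.eval]

@[simp] theorem VPoly.eval_nil (z : ℕ → R) : VPoly.eval ρ g z [] = 0 := rfl

@[simp] theorem VPoly.eval_cons (z : ℕ → R) (t : Term × ℕ) (p : VPoly) :
    VPoly.eval ρ g z (t :: p) = t.1.eval ρ g * z t.2 + VPoly.eval ρ g z p := by simp [VPoly.eval]

@[simp] theorem VPoly.eval_append (z : ℕ → R) (p q : VPoly) :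
    VPoly.eval ρ g z (p ++ q) = VPoly.eval ρ g z p + VPoly.eval ρ g z q := by simp [VPoly.eval]

theorem map_polyEval {R' : Type*} [CommRing R'] [Algebra ℂ R'] (φ : R →ₐ[ℂ] R') (p : Poly) :
    φ (p.eval ρ g) = p.eval ρ (φ ∘ g) := by
  induction p with
  | nil => simp
  | cons t p ih => simp [ih, Term.eval, map_list_prod]

/-- The product of two terms. -/
def Term.mul (s t : Term) : Term :=
  ⟨Int.mul s.coeff t.coeff, s.params ++ t.params, s.mono ++ t.mono⟩

theorem Term.eval_mul (s t : Term) : (s.mul t).eval ρ g = s.eval ρ g * t.eval ρ g := by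
  have : (Int.mul s.coeff t.coeff) = s.coeff * t.coeff := rfl
  simp only [Term.eval, Term.mul, Term.const, this, List.map_append, List.prod_append,
    Int.cast_mul, map_mul]
  ring

/-- Multiplication of a polynomial by a term. -/
def Poly.mulTerm (t : Term) (p : Poly) : Poly := p.map t.mul

/-- Multiplication of a vector polynomial by a term. -/
def VPoly.mulTerm (t : Term) (p : VPoly) : VPoly := p.map fun s => (t.mul s.1, s.2)

theorem Poly.eval_mulTerm (t : Term) (p : Poly) :
    (p.mulTerm t).eval ρ g = t.eval ρ g * p.eval ρ g := by
  induction p with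
  | nil => simp [mulTerm]
  | cons s p ih =>
    simp only [mulTerm, List.map_cons, eval_cons, Term.eval_mul] at ih ⊢
    rw [ih]; ring

theorem VPoly.eval_mulTerm (z : ℕ → R) (t : Term) (p : VPoly) :
    (p.mulTerm t).eval ρ g z = t.eval ρ g * p.eval ρ g z := by
  induction p with
  | nil => simp [mulTerm]
  | cons s p ih =>
    simp only [mulTerm, List.map_cons, eval_cons, Term.eval_mul] at ih ⊢
    rw [ih]; ring

/-- The negative of a polynomial. -/
def Poly.neg (p : Poly) : Poly := p.mulTerm ⟨-1, [], []⟩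

/-- The negative of a vector polynomial. -/
def VPoly.neg (p : VPoly) : VPoly := p.mulTerm ⟨-1, [], []⟩

theorem Poly.eval_neg (p : Poly) : p.neg.eval ρ g = -p.eval ρ g := by
  simp [neg, eval_mulTerm, Term.eval, Term.const]

theorem VPoly.eval_neg (z : ℕ → R) (p : VPoly) : p.neg.eval ρ g z = -p.eval ρ g z := by
  simp [neg, eval_mulTerm, Term.eval, Term.const]

/-- Addition of a term to a polynomial, collecting it with a like term. -/
def Poly.insert (t : Term) : Poly → Poly
  | [] => [t]
  | s :: p => bif s.params.isPerm t.params && s.mono.isPerm t.mono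
    then ⟨Int.add s.coeff t.coeff, s.params, s.mono⟩ :: p else s :: insert t p

/-- A polynomial with like terms collected. -/
def Poly.collect (p : Poly) : Poly := p.foldr insert []

/-- Addition of a term to a vector polynomial, collecting it with a like term. -/
def VPoly.insert (t : Term × ℕ) : VPoly → VPoly
  | [] => [t]
  | s :: p => bif Nat.beq s.2 t.2 && (s.1.params.isPerm t.1.params && s.1.mono.isPerm t.1.mono)
    then (⟨Int.add s.1.coeff t.1.coeff, s.1.params, s.1.mono⟩, s.2) :: p else s :: insert t p

/-- A vector polynomial with like terms collected. -/
def VPoly.collect (p : VPoly) : VPoly := p.foldr insert []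

theorem Term.eval_add_of_like {s t : Term}
    (h : (s.params.isPerm t.params && s.mono.isPerm t.mono) = true) :
    Term.eval ρ g ⟨Int.add s.coeff t.coeff, s.params, s.mono⟩ = s.eval ρ g + t.eval ρ g := by
  rw [Bool.and_eq_true, List.isPerm_iff, List.isPerm_iff] at h
  have hi : Int.add s.coeff t.coeff = s.coeff + t.coeff := rfl
  simp only [Term.eval, Term.const, hi, (h.1.map ρ).prod_eq, (h.2.map g).prod_eq, Int.cast_add,
    ← add_mul, ← map_add]

theorem Poly.eval_insert (t : Term) (p : Poly) :
    (p.insert t).eval ρ g = t.eval ρ g + p.eval ρ g := by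
  induction p with
  | nil => simp [insert]
  | cons s p ih =>
    cases h : (s.params.isPerm t.params && s.mono.isPerm t.mono)
    · simp only [insert, h, cond_false, eval_cons, ih]; ring
    · simp only [insert, h, cond_true, eval_cons, Term.eval_add_of_like ρ g h]; ring

theorem Poly.eval_collect (p : Poly) : p.collect.eval ρ g = p.eval ρ g := by
  induction p with
  | nil => rfl
  | cons s p ih =>
    simp only [collect, List.foldr_cons, eval_insert, eval_cons] at ih ⊢
    rw [ih]

theorem VPoly.eval_insert (z : ℕ → R) (t : Term × ℕ) (p : VPoly) :
    (p.insert t).eval ρ g z = t.1.eval ρ g * z t.2 + p.eval ρ g z := by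
  induction p with
  | nil => simp [insert]
  | cons s p ih =>
    cases h : (Nat.beq s.2 t.2 && (s.1.params.isPerm t.1.params && s.1.mono.isPerm t.1.mono))
    · simp only [insert, h, cond_false, eval_cons, ih]; ring
    · simp only [insert, h, cond_true, eval_cons]
      rw [Bool.and_eq_true] at h
      rw [Term.eval_add_of_like ρ g h.2, Nat.eq_of_beq_eq_true h.1]; ring

theorem VPoly.eval_collect (z : ℕ → R) (p : VPoly) : p.collect.eval ρ g z = p.eval ρ g z := by
  induction p with
  | nil => rfl
  | cons s p ih =>
    simp only [collect, List.foldr_cons, eval_insert, eval_cons] at ih ⊢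
    rw [ih]

/-! ### Derivations acting on lists of terms. -/

/-- The ways to single out an atom of a monomial, each with the remaining atoms. -/
def positions : List Atom → List (Atom × List Atom)
  | [] => []
  | a :: l => (a, l) :: (positions l).map fun x => (x.1, a :: x.2)

/-- The derivative of a term under a derivation with prescribed values at the atoms. -/
def Term.der (da : Atom → Poly) (t : Term) : Poly :=
  (positions t.mono).flatMap fun x => (da x.1).mulTerm ⟨t.coeff, t.params, x.2⟩

/-- The derivative of a polynomial under a derivation with prescribed values at the atoms. -/
def Poly.der (da : Atom → Poly) (p : Poly) : Poly := p.flatMap (Term.der da)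

/-- The derivative of a vector polynomial under a derivation with prescribed values at the atoms and
at the derivatives of `U`. -/
def VPoly.der (da : Atom → Poly) (dz : ℕ → VPoly) (p : VPoly) : VPoly :=
  p.flatMap fun t => (t.1.der da).map (fun s => (s, t.2)) ++ (dz t.2).mulTerm t.1

variable {ρ g}

theorem Poly.eval_flatMap {α : Type*} (f : α → Poly) (L : List α) :
    Poly.eval ρ g (L.flatMap f) = (L.map fun x => (f x).eval ρ g).sum := by
  induction L with
  | nil => simp
  | cons x L ih => simp [ih]

theorem VPoly.eval_flatMap {α : Type*} (z : ℕ → R) (f : α → VPoly) (L : List α) :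
    VPoly.eval ρ g z (L.flatMap f) = (L.map fun x => (f x).eval ρ g z).sum := by
  induction L with
  | nil => simp
  | cons x L ih => simp [ih]

/-- The Leibniz rule for a product over a list: each position contributes the derivative of its
factor times the product of the others. -/
theorem sum_positions (d : Derivation ℂ R R) (l : List Atom) :
    ((positions l).map fun x => (x.2.map g).prod * d (g x.1)).sum = d (l.map g).prod := by
  induction l with
  | nil => simp [positions]
  | cons a l ih =>
    simp [positions, Function.comp_def, mul_assoc, List.sum_map_mul_left, ih]
    ring

theorem Term.eval_der {d : Derivation ℂ R R} {da : Atom → Poly}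
    (h : ∀ a, (da a).eval ρ g = d (g a)) (t : Term) : (t.der da).eval ρ g = d (t.eval ρ g) := by
  simp only [der, Poly.eval_flatMap, Poly.eval_mulTerm, h, Term.eval, Term.const, mul_assoc,
    List.sum_map_mul_left, sum_positions]
  simp

theorem Poly.eval_der {d : Derivation ℂ R R} {da : Atom → Poly}
    (h : ∀ a, (da a).eval ρ g = d (g a)) (p : Poly) :
    (p.der da).eval ρ g = d (p.eval ρ g) := by
  induction p with
  | nil => simp [der]
  | cons t p ih =>
    simp only [der, List.flatMap_cons, eval_append, eval_cons, map_add] at ih ⊢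
    rw [ih, Term.eval_der h]

theorem VPoly.eval_map_pair (z : ℕ → R) (p : Poly) (k : ℕ) :
    VPoly.eval ρ g z (p.map fun s => (s, k)) = p.eval ρ g * z k := by
  induction p with
  | nil => simp
  | cons t p ih => simp [ih]; ring

theorem VPoly.eval_der {d : Derivation ℂ R R} {da : Atom → Poly} {dz : ℕ → VPoly} {z : ℕ → R}
    (h : ∀ a, (da a).eval ρ g = d (g a)) (hz : ∀ k, (dz k).eval ρ g z = d (z k)) (p : VPoly) :
    (p.der da dz).eval ρ g z = d (p.eval ρ g z) := by
  induction p with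
  | nil => simp [der]
  | cons t p ih =>
    simp only [der, List.flatMap_cons, eval_append, eval_cons, map_add] at ih ⊢
    rw [ih, eval_mulTerm, eval_map_pair, Term.eval_der h, hz]
    simp
    ring

end Eval

/-! ### Total derivatives, flows and commutators -/

/-- The total `x`-derivative of an atom. -/
def Atom.dx : Atom → Poly
  | .u m => [⟨1, [], [.u (m + 1)]⟩]
  | .dot m 0 => [⟨2, [], [.dot m 1]⟩]
  | .dot m (e + 1) => [⟨1, [], [.dot (m + 1) e]⟩, ⟨1, [], [.dot m (e + 2)]⟩]

/-- The total `x`-derivative of a polynomial. -/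
def Poly.dx (p : Poly) : Poly := (p.der Atom.dx).collect

/-- The total `x`-derivative of a vector polynomial. -/
def VPoly.dx (p : VPoly) : VPoly :=
  (p.der Atom.dx fun k => [(⟨1, [], []⟩, k + 1)]).collect

/-- The iterated total `x`-derivative of a polynomial, computed term by term. -/
def Poly.dxIter (m : ℕ) (p : Poly) : Poly := p.flatMap fun t => Poly.dx^[m] [t]

/-- The iterated total `x`-derivative of a vector polynomial, computed term by term. -/
def VPoly.dxIter (m : ℕ) (p : VPoly) : VPoly := p.flatMap fun t => VPoly.dx^[m] [t]

/-- The scalar product of a vector polynomial with `∂ₓⁿ U`. -/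
def VPoly.contract (n : ℕ) (p : VPoly) : Poly :=
  p.map fun t => ⟨t.1.coeff, t.1.params, .inner t.2 n :: t.1.mono⟩

/-- The time derivative of an atom under the flow with right-hand sides `H` and `K`. -/
def Atom.dt (H : Poly) (K : VPoly) : Atom → Poly
  | .u m => H.dxIter m
  | .dot m e => (K.dxIter m).contract (m + e) ++ (K.dxIter (m + e)).contract m

/-- The scalar part of the commutator of the flows `(H, K)` and `(H', K')`. -/
def commScalar (H : Poly) (K : VPoly) (H' : Poly) (K' : VPoly) : Poly :=
  H.der (Atom.dt H' K') ++ (H'.der (Atom.dt H K)).neg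

/-- The vector part of the commutator of the flows `(H, K)` and `(H', K')`. -/
def commVector (H : Poly) (K : VPoly) (H' : Poly) (K' : VPoly) : VPoly :=
  K.der (Atom.dt H' K') (fun k => K'.dxIter k) ++
    (K'.der (Atom.dt H K) fun k => K.dxIter k).neg

/-! ### Agreement of the formal operations with those on components. -/

section Components

variable (N : ℕ) (ρ : ℕ → ℂ)

/-- An atom written in the components of `U`. -/
noncomputable def Atom.toComponents (a : Atom) : DiffPoly N := a.toFactor.toComponents N

variable {N}

theorem dotComponents_mk (m n : ℕ) :
    dotComponents N s(m, n) = ∑ j : Fin N, (X (some j, m) * X (some j, n) : DiffPoly N) := rfl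

theorem Atom.toComponents_inner (m n : ℕ) : (Atom.inner m n).toComponents N =
    ∑ j : Fin N, (X (some j, m) * X (some j, n) : DiffPoly N) := by
  rw [Atom.toComponents, Atom.toFactor_inner, Factor.toComponents, dotComponents_mk]

theorem Dx_X (v : Option (Fin N) × ℕ) : Dx N (X v) = X (v.1, v.2 + 1) := by
  simp [Dx, mkDerivation_X]

theorem Dt_X (F : Option (Fin N) → DiffPoly N) (v : Option (Fin N) × ℕ) :
    Dt F (X v) = (Dx N)^[v.2] (F v.1) := by
  simp [Dt, mkDerivation_X]

variable {ρ}

theorem Atom.toComponents_dot (m e : ℕ) : (Atom.dot m e).toComponents N =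
    ∑ j : Fin N, (X (some j, m) * X (some j, m + e) : DiffPoly N) := rfl

theorem Atom.eval_dx (a : Atom) :
    a.dx.eval ρ (Atom.toComponents N) = Dx N (a.toComponents N) := by
  rcases a with m | ⟨m, _ | e⟩
  · simp [dx, Term.eval, Term.const, toComponents, toFactor, Factor.toComponents, Dx_X]
  · simp only [dx, Poly.eval_cons, Poly.eval_nil, Term.eval, Term.const, toComponents_dot, map_sum,
      Derivation.leibniz, Dx_X, List.map_cons, List.map_nil, List.prod_cons, List.prod_nil,
      Finset.mul_sum, mul_one, add_zero, smul_eq_mul]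
    refine Finset.sum_congr rfl fun j _ => ?_
    simp only [Int.cast_ofNat, map_ofNat]
    ring
  · simp only [dx, Poly.eval_cons, Poly.eval_nil, Term.eval, Term.const, toComponents_dot, map_sum,
      Derivation.leibniz, Dx_X, List.map_cons, List.map_nil, List.prod_cons, List.prod_nil,
      mul_one, add_zero, smul_eq_mul, Int.cast_one, map_one, one_mul, ← Finset.sum_add_distrib]
    refine Finset.sum_congr rfl fun j _ => ?_
    rw [show m + 1 + e = m + (e + 1) by ring, show m + (e + 2) = m + (e + 1) + 1 by ring]
    ring

theorem Poly.eval_dx (p : Poly) :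
    p.dx.eval ρ (Atom.toComponents N) = Dx N (p.eval ρ (Atom.toComponents N)) := by
  rw [dx, eval_collect, eval_der Atom.eval_dx]

theorem Poly.eval_dx_iterate (p : Poly) (m : ℕ) :
    (dx^[m] p).eval ρ (Atom.toComponents N) = (Dx N)^[m] (p.eval ρ (Atom.toComponents N)) := by
  induction m with
  | zero => rfl
  | succ m ih => rw [Function.iterate_succ_apply', Function.iterate_succ_apply', eval_dx, ih]

/-- This is what permits `dxIter` to differentiate term by term. -/
theorem iterate_map_list_sum (d : DiffPoly N →+ DiffPoly N) (m : ℕ) (L : List (DiffPoly N)) :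
    d^[m] L.sum = (L.map d^[m]).sum := by
  induction L with
  | nil => simp [iterate_map_zero]
  | cons x L ih => simp [iterate_map_add, ih]

theorem Poly.eval_dxIter (p : Poly) (m : ℕ) :
    (p.dxIter m).eval ρ (Atom.toComponents N) = (Dx N)^[m] (p.eval ρ (Atom.toComponents N)) := by
  have := iterate_map_list_sum (Dx N : DiffPoly N →+ DiffPoly N) m
    (p.map (Term.eval ρ (Atom.toComponents N)))
  rw [dxIter, eval_flatMap]
  simp only [eval_dx_iterate, eval_cons, eval_nil, add_zero]
  simpa [Function.comp_def, eval] using this.symm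

theorem VPoly.eval_dx (p : VPoly) (j : Fin N) :
    p.dx.eval ρ (Atom.toComponents N) (fun k => X (some j, k)) =
      Dx N (p.eval ρ (Atom.toComponents N) fun k => X (some j, k)) := by
  rw [dx, eval_collect, eval_der Atom.eval_dx]
  intro k
  simp [Dx_X, Term.eval, Term.const]

theorem VPoly.eval_dx_iterate (p : VPoly) (j : Fin N) (m : ℕ) :
    (dx^[m] p).eval ρ (Atom.toComponents N) (fun k => X (some j, k)) =
      (Dx N)^[m] (p.eval ρ (Atom.toComponents N) fun k => X (some j, k)) := by
  induction m with
  | zero => rfl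
  | succ m ih => rw [Function.iterate_succ_apply', Function.iterate_succ_apply', eval_dx, ih]

theorem VPoly.eval_dxIter (p : VPoly) (j : Fin N) (m : ℕ) :
    (p.dxIter m).eval ρ (Atom.toComponents N) (fun k => X (some j, k)) =
      (Dx N)^[m] (p.eval ρ (Atom.toComponents N) fun k => X (some j, k)) := by
  have := iterate_map_list_sum (Dx N : DiffPoly N →+ DiffPoly N) m
    (p.map fun t => t.1.eval ρ (Atom.toComponents N) * X (some j, t.2))
  rw [dxIter, eval_flatMap]
  simp only [eval_dx_iterate, eval_cons, eval_nil, add_zero]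
  simpa [Function.comp_def, eval] using this.symm

theorem VPoly.eval_contract (p : VPoly) (n : ℕ) :
    (p.contract n).eval ρ (Atom.toComponents N) =
      ∑ j : Fin N, p.eval ρ (Atom.toComponents N) (fun k => X (some j, k)) * X (some j, n) := by
  induction p with
  | nil => simp [contract]
  | cons t p ih =>
    simp only [contract, List.map_cons, Poly.eval_cons, VPoly.eval_cons, add_mul,
      Finset.sum_add_distrib] at ih ⊢
    rw [ih]
    congr 1
    simp only [Term.eval, Term.const, List.map_cons, List.prod_cons, Atom.toComponents_inner,
      Finset.sum_mul, Finset.mul_sum]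
    exact Finset.sum_congr rfl fun j _ => by ring

variable (ρ)

/-- The system with the right-hand sides `H` and `K` in the components of `U` is that of `S`. -/
structure EvSystem.IsGivenBy (S : EvSystem) (H : Poly) (K : VPoly) : Prop where
  scalar : ∀ N, S.rhs N none = H.eval ρ (Atom.toComponents N)
  vector : ∀ N j, S.rhs N (some j) =
    K.eval ρ (Atom.toComponents N) fun k => X (some j, k)

variable {ρ} {S T : EvSystem} {H H' : Poly} {K K' : VPoly}

theorem EvSystem.IsGivenBy.eval_dt (hS : S.IsGivenBy ρ H K) (a : Atom) :
    (a.dt H K).eval ρ (Atom.toComponents N) = Dt (S.rhs N) (a.toComponents N) := by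
  rcases a with m | ⟨m, e⟩
  · simp [Atom.dt, Atom.toComponents, Atom.toFactor, Factor.toComponents, Dt_X,
      Poly.eval_dxIter, hS.scalar]
  · simp only [Atom.dt, Poly.eval_append, VPoly.eval_contract, VPoly.eval_dxIter,
      Atom.toComponents, Atom.toFactor, Factor.toComponents, dotComponents_mk, map_sum,
      Derivation.leibniz, Dt_X, hS.vector, smul_eq_mul, Finset.sum_add_distrib]
    rw [add_comm]
    congr 1 <;> exact Finset.sum_congr rfl fun j _ => by ring

theorem EvSystem.IsGivenBy.eval_commScalar (hS : S.IsGivenBy ρ H K) (hT : T.IsGivenBy ρ H' K')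
    (h : S.CommutesWith T N) : (commScalar H K H' K').eval ρ (Atom.toComponents N) = 0 := by
  rw [commScalar, Poly.eval_append, Poly.eval_neg, Poly.eval_der hT.eval_dt,
    Poly.eval_der hS.eval_dt, ← hS.scalar, ← hT.scalar, h none, add_neg_cancel]

theorem EvSystem.IsGivenBy.eval_commVector (hS : S.IsGivenBy ρ H K) (hT : T.IsGivenBy ρ H' K')
    (h : S.CommutesWith T N) (j : Fin N) :
    (commVector H K H' K').eval ρ (Atom.toComponents N) (fun k => X (some j, k)) = 0 := by
  have aux : ∀ {S : EvSystem} {H : Poly} {K : VPoly}, S.IsGivenBy ρ H K → ∀ k : ℕ,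
      (K.dxIter k).eval ρ (Atom.toComponents N) (fun k => X (some j, k)) =
        Dt (S.rhs N) (X (some j, k)) := fun hS k => by
    rw [Dt_X, VPoly.eval_dxIter, hS.vector]
  rw [commVector, VPoly.eval_append, VPoly.eval_neg, VPoly.eval_der hT.eval_dt (aux hT),
    VPoly.eval_der hS.eval_dt (aux hS), ← hS.vector, ← hT.vector, h (some j), add_neg_cancel]

end Components

/-! ### Independence of the scalar products -/

/-- Any symmetric matrix `G` is a Gram matrix of complex vectors. For vectors with the two halves `p
+ q` and `i(p - q)` the bilinear form is `2(p·q' + q·p')`. With `p` the basis vector `δ m` and `q` a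
quarter of the row `G m` its value is `(G n m + G m n) / 2`. -/
theorem exists_components (M : ℕ) (g : Factor → ℂ) :
    ∃ x : Option (Fin (M + M)) × ℕ → ℂ, ∀ f : Factor, f.order < M →
      eval x (f.toComponents (M + M)) = g f := by
  let G : ℕ → ℕ → ℂ := fun m n => g (.dot s(m, n))
  let δ : ℕ → Fin M → ℂ := fun m i => if m = i then 1 else 0
  let x : Option (Fin (M + M)) × ℕ → ℂ := fun v => v.1.elim (g (.u v.2)) fun j =>
    Fin.addCases (fun i => δ v.2 i + G v.2 i / 4)
      (fun i => Complex.I * (δ v.2 i - G v.2 i / 4)) j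
  refine ⟨x, fun f hf => ?_⟩
  rcases f with m | p
  · simp [Factor.toComponents, x]
  · induction p using Sym2.ind with
    | _ m n =>
      have hm : m < M := (le_max_left m n).trans_lt hf
      have hn : n < M := (le_max_right m n).trans_lt hf
      have key : ∀ i : Fin M, (δ m i + G m i / 4) * (δ n i + G n i / 4) +
          Complex.I * (δ m i - G m i / 4) * (Complex.I * (δ n i - G n i / 4)) =
          (δ m i * G n i + δ n i * G m i) / 2 := fun i => by
        linear_combination (δ m i - G m i / 4) * (δ n i - G n i / 4) * Complex.I_sq
      have hδ : ∀ (k : ℕ) (hk : k < M) (h : ℕ → ℂ), ∑ i : Fin M, δ k i * h i = h k := by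
        intro k hk h
        rw [Finset.sum_eq_single ⟨k, hk⟩ _ (by simp)]
        · simp [δ]
        · intro i _ hi
          simp [δ, show k ≠ i from fun e => hi (Fin.ext e.symm)]
      have hG : G n m = G m n := by simp [G, Sym2.eq_swap]
      have hl : ∀ (k : ℕ) (i : Fin M), x (some (Fin.castAdd M i), k) = δ k i + G k i / 4 :=
        fun k i => by simp [x]
      have hr : ∀ (k : ℕ) (i : Fin M),
          x (some (Fin.natAdd M i), k) = Complex.I * (δ k i - G k i / 4) := fun k i => by
        simp only [x, Option.elim, Fin.addCases_right]
      rw [Factor.toComponents, dotComponents_mk, map_sum, Fin.sum_univ_add]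
      simp only [map_mul, eval_X, hl, hr]
      rw [← Finset.sum_add_distrib, Finset.sum_congr rfl fun i _ => key i, ← Finset.sum_div,
        Finset.sum_add_distrib, hδ m hm, hδ n hn, hG]
      simp [G]

/-- A polynomial over an infinite field is determined by its values, and the finitely many factors
in `P` can take arbitrary values simultaneously once `N` is large. -/
theorem eq_zero_of_toComponents_eq_zero {P : ScalarExpr}
    (h : ∀ N, 1 ≤ N → ScalarExpr.toComponents N P = 0) : P = 0 := by
  refine MvPolynomial.funext fun g => ?_
  obtain ⟨M, hM⟩ : ∃ M, ∀ f ∈ P.vars, f.order < M :=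
    ⟨P.vars.sup Factor.order + 1, fun f hf => Nat.lt_succ_of_le (Finset.le_sup hf)⟩
  -- `M + 1` instead of `M` guarantees at least one component.
  obtain ⟨x, hx⟩ := exists_components (M + 1) g
  have h0 : eval x (ScalarExpr.toComponents (M + 1 + (M + 1)) P) = 0 := by
    rw [h _ (by omega), map_zero]
  rw [map_zero, ← h0, ScalarExpr.toComponents, aeval_def, ← coe_eval₂Hom, ← RingHom.comp_apply,
    comp_eval₂Hom, ← eval₂_id, ← coe_eval₂Hom]
  refine eval₂Hom_congr' (by ext; simp) (fun f hf _ => ?_) rfl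
  exact (hx f ((hM f hf).trans (Nat.lt_succ_self M))).symm

/-! ### Coefficients -/

noncomputable instance : DecidableEq Factor := Classical.decEq Factor

/-- The terms of a polynomial with a given monomial. -/
def Poly.termsAt (l : List Atom) (p : Poly) : Poly := p.filter fun t => t.mono.isPerm l

/-- The coefficient that a list of terms with the same monomial adds up to. -/
def Poly.total (ρ : ℕ → ℂ) (p : Poly) : ℂ := (p.map (Term.const ρ)).sum

theorem prod_map_X (l : List Atom) :
    (l.map fun a => (X a.toFactor : ScalarExpr)).prod =
      monomial (Multiset.toFinsupp (l.map Atom.toFactor : Multiset Factor)) 1 := by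
  induction l with
  | nil => simp
  | cons a l ih =>
    rw [List.map_cons, List.prod_cons, ih, X, monomial_mul, List.map_cons, ← Multiset.cons_coe,
      ← Multiset.singleton_add, map_add, Multiset.toFinsupp_singleton, one_mul]

theorem coeff_eval (ρ : ℕ → ℂ) (l : List Atom) (p : Poly) :
    coeff (Multiset.toFinsupp (l.map Atom.toFactor : Multiset Factor))
      (p.eval ρ fun a => (X a.toFactor : ScalarExpr)) = (p.termsAt l).total ρ := by
  induction p with
  | nil => simp [Poly.termsAt, Poly.total]
  | cons t p ih =>
    have key : Multiset.toFinsupp (t.mono.map Atom.toFactor : Multiset Factor) =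
        Multiset.toFinsupp (l.map Atom.toFactor : Multiset Factor) ↔ t.mono.isPerm l = true := by
      rw [List.isPerm_iff, Multiset.toFinsupp.injective.eq_iff, Multiset.coe_eq_coe,
        List.map_perm_map_iff Atom.toFactor_injective]
    rw [Poly.eval_cons, coeff_add, ih, Term.eval, prod_map_X, algebraMap_eq, coeff_C_mul,
      coeff_monomial]
    by_cases h : t.mono.isPerm l = true
    · rw [if_pos (key.2 h)]
      simp [Poly.termsAt, Poly.total, h]
    · rw [if_neg (fun e => h (key.1 e))]
      simp [Poly.termsAt, Poly.total, h]

variable {ρ : ℕ → ℂ} {S T : EvSystem} {H H' : Poly} {K K' : VPoly}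

theorem total_eq_zero {p : Poly} (h : ∀ N, 1 ≤ N → p.eval ρ (Atom.toComponents N) = 0)
    (l : List Atom) : (p.termsAt l).total ρ = 0 := by
  rw [← coeff_eval, eq_zero_of_toComponents_eq_zero (P := p.eval ρ fun a => X a.toFactor),
    coeff_zero]
  intro N hN
  rw [← h N hN, ScalarExpr.toComponents, map_polyEval]
  congr 1
  ext1 a
  simp [Atom.toComponents]

theorem EvSystem.IsGivenBy.total_commScalar (hS : S.IsGivenBy ρ H K) (hT : T.IsGivenBy ρ H' K')
    (h : ∀ N, 1 ≤ N → S.CommutesWith T N) (l : List Atom) :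
    ((commScalar H K H' K').termsAt l).total ρ = 0 :=
  total_eq_zero (fun N hN => hS.eval_commScalar hT (h N hN)) l

/-- The terms of a vector polynomial with a given monomial and a given derivative of `U`. -/
def VPoly.termsAt (l : List Atom) (k : ℕ) (p : VPoly) : Poly :=
  (p.filter fun t => Nat.beq t.2 k && t.1.mono.isPerm l).map Prod.fst

/-- The highest order of a derivative in an atom. -/
def Atom.order : Atom → ℕ
  | .u m => m
  | .dot m e => m + e

theorem VPoly.total_contract {n k : ℕ} {l : List Atom} (hk : k < n) (hl : ∀ a ∈ l, a.order < n)
    {p : VPoly} (hp : ∀ t ∈ p, t.2 < n ∧ ∀ a ∈ t.1.mono, a.order < n) :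
    ((p.contract n).termsAt (.inner k n :: l)).total ρ = (p.termsAt l k).total ρ := by
  induction p with
  | nil => rfl
  | cons t p ih =>
    have hi : ∀ {k}, k < n → Atom.inner k n = .dot k (n - k) := fun {k} h => by
      simp [Atom.inner, Nat.ble_eq_true_of_le h.le]
    have ht := hp t (by simp)
    have ih := ih fun s hs => hp s (List.mem_cons_of_mem t hs)
    have key : (Atom.inner t.2 n :: t.1.mono).isPerm (.inner k n :: l) =
        (Nat.beq t.2 k && t.1.mono.isPerm l) := by
      rw [Bool.eq_iff_iff, Bool.and_eq_true, List.isPerm_iff, List.isPerm_iff, Nat.beq_eq]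
      constructor
      · intro h
        have hmem : Atom.inner t.2 n ∈ Atom.inner k n :: l := h.subset (by simp)
        have hkt : t.2 = k := by
          rcases List.mem_cons.1 hmem with h' | h'
          · rw [hi hk, hi ht.1] at h'
            exact (Atom.dot.inj h').1
          · have := hl _ h'
            rw [hi ht.1, Atom.order] at this
            omega
        rw [hkt] at h
        exact ⟨hkt, (List.perm_cons _).1 h⟩
      · rintro ⟨rfl, h⟩
        exact h.cons _
    simp only [contract, Poly.termsAt, Poly.total, termsAt, List.map_cons] at ih ⊢
    rw [List.filter_cons, List.filter_cons]
    simp only [key]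
    by_cases h : (Nat.beq t.2 k && t.1.mono.isPerm l) = true
    · rw [if_pos h, if_pos h, List.map_cons, List.map_cons, List.map_cons, List.sum_cons,
        List.sum_cons, ih]
      rfl
    · rw [if_neg h, if_neg h, ih]

theorem VPoly.exists_bound (p : VPoly) (l : List Atom) (k : ℕ) :
    ∃ n, k < n ∧ (∀ a ∈ l, a.order < n) ∧
      ∀ t ∈ p, t.2 < n ∧ ∀ a ∈ t.1.mono, a.order < n := by
  have hle : ∀ (L : List ℕ) (i : ℕ), i ∈ L → i ≤ L.sum := fun L i h => List.single_le_sum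
    (fun _ _ => Nat.zero_le _) i h
  refine ⟨k + (l.map Atom.order).sum +
    (p.map fun t => t.2 + (t.1.mono.map Atom.order).sum).sum + 1, by omega, fun a ha => ?_,
    fun t ht => ?_⟩
  · have := hle _ _ (List.mem_map_of_mem (f := Atom.order) ha)
    omega
  · have h := hle _ _ (List.mem_map_of_mem
      (f := fun t : Term × ℕ => t.2 + (t.1.mono.map Atom.order).sum) ht)
    refine ⟨by omega, fun a ha => ?_⟩
    have := hle _ _ (List.mem_map_of_mem (f := Atom.order) ha)
    omega

theorem EvSystem.IsGivenBy.total_commVector (hS : S.IsGivenBy ρ H K) (hT : T.IsGivenBy ρ H' K')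
    (h : ∀ N, 1 ≤ N → S.CommutesWith T N) (l : List Atom) (k : ℕ) :
    ((commVector H K H' K').termsAt l k).total ρ = 0 := by
  obtain ⟨n, hk, hl, hp⟩ := VPoly.exists_bound (commVector H K H' K') l k
  rw [← VPoly.total_contract hk hl hp]
  exact total_eq_zero (fun N hN => by
    simp [VPoly.eval_contract, hS.eval_commVector hT (h N hN)]) _

/-! ### Extraction of single coefficients of a commutator -/

/-- The monomial `l` divided by the monomial `r`. -/
def remove : List Atom → List Atom → Option (List Atom)
  | [], l => some l
  | a :: r, l => bif l.contains a then remove r (l.erase a) else none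

/-- `List.isPerm` consumes its first argument entry by entry, erasing each from the second. On the
prefix `r` this is division by the monomial `r`. -/
theorem isPerm_append (r s l : List Atom) :
    (r ++ s).isPerm l = ((remove r l).elim false fun m => s.isPerm m) := by
  induction r generalizing l with
  | nil => simp [remove]
  | cons a r ih =>
    rw [List.cons_append, List.isPerm]
    rw [remove]
    cases l.contains a <;> simp [ih]

/-- The terms at `l` of the product of a term and a polynomial. -/
def Poly.termsAtMul (l : List Atom) (t : Term) (p : Poly) : Poly :=
  match remove t.mono l with
  | none => []
  | some m => (p.termsAt m).mulTerm t

/-- The terms at `l` and `∂ₓᵏ U` of the product of a term and a vector polynomial. -/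
def VPoly.termsAtMul (l : List Atom) (k : ℕ) (t : Term) (p : VPoly) : Poly :=
  match remove t.mono l with
  | none => []
  | some m => (p.termsAt m k).mulTerm t

theorem Poly.termsAt_mulTerm (l : List Atom) (t : Term) (p : Poly) :
    (p.mulTerm t).termsAt l = termsAtMul l t p := by
  have : ∀ s : Term, (t.mul s).mono = t.mono ++ s.mono := fun _ => rfl
  unfold termsAt mulTerm termsAtMul
  rw [List.filter_map]
  simp only [Function.comp_def, this, isPerm_append]
  cases remove t.mono l <;> simp [mulTerm, termsAt]

theorem VPoly.termsAt_mulTerm (l : List Atom) (k : ℕ) (t : Term) (p : VPoly) :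
    (p.mulTerm t).termsAt l k = termsAtMul l k t p := by
  have : ∀ s : Term, (t.mul s).mono = t.mono ++ s.mono := fun _ => rfl
  unfold termsAt mulTerm termsAtMul
  rw [List.filter_map]
  simp only [Function.comp_def, this, isPerm_append]
  cases remove t.mono l <;> simp [Poly.mulTerm, termsAt]

/-- The terms at `l` of the derivative of a term. -/
def Term.derAt (l : List Atom) (da : Atom → Poly) (t : Term) : Poly :=
  (positions t.mono).flatMap fun x => Poly.termsAtMul l ⟨t.coeff, t.params, x.2⟩ (da x.1)

theorem Term.termsAt_der (l : List Atom) (da : Atom → Poly) (t : Term) :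
    (t.der da).termsAt l = t.derAt l da := by
  simp only [der, derAt, ← Poly.termsAt_mulTerm]
  simp only [Poly.termsAt, List.filter_flatMap]

/-- The terms at `l` of the scalar part of a commutator. -/
def commScalarAt (l : List Atom) (H : Poly) (K : VPoly) (H' : Poly) (K' : VPoly) : Poly :=
  H.flatMap (Term.derAt l (Atom.dt H' K')) ++
    Poly.neg (H'.flatMap (Term.derAt l (Atom.dt H K)))

/-- The terms at `l` and `∂ₓᵏ U` of the vector part of a commutator. -/
def commVectorAt (l : List Atom) (k : ℕ) (H : Poly) (K : VPoly) (H' : Poly) (K' : VPoly) : Poly :=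
  (K.flatMap fun t => (bif Nat.beq t.2 k then t.1.derAt l (Atom.dt H' K') else []) ++
    VPoly.termsAtMul l k t.1 (K'.dxIter t.2)) ++
  Poly.neg (K'.flatMap fun t => (bif Nat.beq t.2 k then t.1.derAt l (Atom.dt H K) else []) ++
    VPoly.termsAtMul l k t.1 (K.dxIter t.2))

theorem Poly.termsAt_append (l : List Atom) (p q : Poly) :
    (p ++ q).termsAt l = p.termsAt l ++ q.termsAt l := List.filter_append ..

theorem VPoly.termsAt_append (l : List Atom) (k : ℕ) (p q : VPoly) :
    (p ++ q).termsAt l k = p.termsAt l k ++ q.termsAt l k := by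
  simp [termsAt, List.filter_append]

theorem Poly.termsAt_neg (l : List Atom) (p : Poly) : p.neg.termsAt l = (p.termsAt l).neg :=
  termsAt_mulTerm ..

theorem VPoly.termsAt_neg (l : List Atom) (k : ℕ) (p : VPoly) :
    p.neg.termsAt l k = (p.termsAt l k).neg :=
  termsAt_mulTerm ..

/-- Selecting one monomial is distributed over sums and over products with a term, so that a single
coefficient can be evaluated without forming all products in the commutator. -/
theorem termsAt_commScalar (l : List Atom) :
    (commScalar H K H' K').termsAt l = commScalarAt l H K H' K' := by
  have h : ∀ (p : Poly) (da : Atom → Poly), (p.der da).termsAt l = p.flatMap (Term.derAt l da) :=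
    fun p da => by
      rw [show Term.derAt l da = fun t => (t.der da).termsAt l from
        funext fun t => (Term.termsAt_der l da t).symm]
      simp only [Poly.der, Poly.termsAt, List.filter_flatMap]
  rw [commScalar, Poly.termsAt_append, Poly.termsAt_neg, h, h, commScalarAt]

theorem VPoly.termsAt_map_pair (l : List Atom) (k i : ℕ) (p : Poly) :
    VPoly.termsAt l k (p.map fun s => (s, i)) = bif Nat.beq i k then p.termsAt l else [] := by
  rw [termsAt, List.filter_map, List.map_map]
  cases h : Nat.beq i k <;> simp [Function.comp_def, h, Poly.termsAt]

theorem termsAt_commVector (l : List Atom) (k : ℕ) :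
    (commVector H K H' K').termsAt l k = commVectorAt l k H K H' K' := by
  have h : ∀ (p : VPoly) (da : Atom → Poly) (dz : ℕ → VPoly), (p.der da dz).termsAt l k =
      p.flatMap fun t => (bif Nat.beq t.2 k then t.1.derAt l da else []) ++
        VPoly.termsAtMul l k t.1 (dz t.2) := fun p da dz => by
    simp only [← Term.termsAt_der, ← VPoly.termsAt_mulTerm, ← VPoly.termsAt_map_pair,
      ← VPoly.termsAt_append]
    simp only [VPoly.termsAt, VPoly.der, List.filter_flatMap, List.map_flatMap]
  rw [commVector, VPoly.termsAt_append, VPoly.termsAt_neg, h, h, commVectorAt]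

/-! ### The general homogeneous system -/

/-- Three times the weight of an atom. -/
def Atom.weight : Atom → ℕ
  | .u m => 2 + 3 * m
  | .dot m e => 2 + 3 * (2 * m + e)

/-- A finite list of atoms that contains all those of weight at most `3 * r + 2`. -/
def atoms (r : ℕ) : List Atom :=
  (List.range (r + 1)).map .u ++
    (List.range (r + 1)).flatMap fun m => (List.range (r + 1)).map (.dot m)

/-- The monomials of weight `W` in the given atoms; the first argument bounds the recursion. -/
def monomials : ℕ → ℕ → List Atom → List (List Atom)
  | 0, _, _ => []
  | _ + 1, W, [] => bif Nat.beq W 0 then [[]] else []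
  | n + 1, W, a :: l => monomials n W l ++
      bif Nat.ble a.weight W then (monomials n (W - a.weight) (a :: l)).map (a :: ·) else []

/-- The monomials of weight `W`, if `W` is at most `3 * r + 2`. -/
def allMonomials (r W : ℕ) : List (List Atom) := monomials (W + (atoms r).length + 1) W (atoms r)

/-- The polynomial with given monomials and parameters with consecutive indices as coefficients. -/
def ansatz (i : ℕ) : List (List Atom) → Poly
  | [] => []
  | l :: L => ⟨1, [i], l⟩ :: ansatz (i + 1) L

/-- The scalar part of the general system that is homogeneous of weight `r`. -/
def scalarAnsatz (r : ℕ) : Poly := ansatz 100 (allMonomials r (3 * r + 2))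

/-- The vector part of the general system that is homogeneous of weight `r`. -/
def vectorAnsatz (r : ℕ) : VPoly :=
  (List.range (r + 1)).flatMap fun k =>
    (ansatz (100 * (k + 2)) (allMonomials r (3 * r - 3 * k))).map fun t => (t, k)

theorem mem_monomials_subset {n W : ℕ} {A l : List Atom} (h : l ∈ monomials n W A) : l ⊆ A := by
  induction n generalizing W A l with
  | zero => simp [monomials] at h
  | succ n ih =>
    cases A with
    | nil =>
      cases hW : Nat.beq W 0 <;> simp_all [monomials]
    | cons a A =>
      rw [monomials, List.mem_append] at h
      rcases h with h | h
      · exact List.subset_cons_of_subset a (ih h)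
      · cases hW : Nat.ble a.weight W
        · simp [hW] at h
        · rw [hW, cond_true, List.mem_map] at h
          obtain ⟨m, hm, rfl⟩ := h
          exact List.cons_subset.2 ⟨by simp, ih hm⟩

/-- Entries of the first sublist avoid the head atom `a`, because `A` has no repetitions, while
those of the second contain it. -/
theorem pairwise_monomials (n W : ℕ) {A : List Atom} (hA : A.Nodup) :
    (monomials n W A).Pairwise fun l m => ¬ l.Perm m := by
  induction n generalizing W A with
  | zero => simp [monomials]
  | succ n ih =>
    cases A with
    | nil => cases hW : Nat.beq W 0 <;> simp [monomials, hW]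
    | cons a A =>
      rw [monomials, List.pairwise_append]
      refine ⟨ih W hA.of_cons, ?_, fun l hl m hm h => ?_⟩
      · cases Nat.ble a.weight W
        · simp
        · simpa [List.pairwise_map] using ih (W - a.weight) hA
      · cases hW : Nat.ble a.weight W
        · simp [hW] at hm
        · rw [hW, cond_true, List.mem_map] at hm
          obtain ⟨m, -, rfl⟩ := hm
          exact (List.nodup_cons.1 hA).1 (mem_monomials_subset hl (h.mem_iff.2 (by simp)))

theorem Atom.two_le_weight (a : Atom) : 2 ≤ a.weight := by cases a <;> simp [weight]

/-- Each recursive call drops an atom from the list or lowers the weight by at least two, so weight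
plus length bounds the depth of the recursion. -/
theorem exists_mem_monomials {n : ℕ} {A l : List Atom} (hl : l ⊆ A)
    (hn : (l.map Atom.weight).sum + A.length < n) :
    ∃ m ∈ monomials n (l.map Atom.weight).sum A, m.Perm l := by
  induction n generalizing A l with
  | zero => omega
  | succ n ih =>
    cases A with
    | nil =>
      obtain rfl := List.subset_nil.1 hl
      exact ⟨[], by simp [monomials], .refl _⟩
    | cons a A =>
      rw [List.length_cons] at hn
      by_cases ha : a ∈ l
      · have hp := List.perm_cons_erase ha
        have hs : (l.map Atom.weight).sum = a.weight + ((l.erase a).map Atom.weight).sum := by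
          rw [(hp.map _).sum_eq, List.map_cons, List.sum_cons]
        have := a.two_le_weight
        obtain ⟨m, hm, h⟩ := ih (A := a :: A) (l := l.erase a)
          (fun b hb => hl (List.mem_of_mem_erase hb)) (by rw [List.length_cons]; omega)
        refine ⟨a :: m, ?_, (h.cons a).trans hp.symm⟩
        rw [monomials, List.mem_append]
        right
        rw [hs, Nat.ble_eq_true_of_le (Nat.le_add_right _ _), Nat.add_sub_cancel_left]
        exact List.mem_map_of_mem hm
      · obtain ⟨m, hm, h⟩ := ih (A := A) (l := l)
          (fun b hb => (List.mem_cons.1 (hl hb)).resolve_left fun e => ha (e ▸ hb)) (by omega)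
        exact ⟨m, by rw [monomials]; exact List.mem_append_left _ hm, h⟩

theorem mem_atoms {r : ℕ} {a : Atom} (h : a.weight ≤ 3 * r + 2) : a ∈ atoms r := by
  cases a <;> simp [atoms, Atom.weight] at h ⊢ <;> omega

theorem exists_mem_allMonomials {r : ℕ} {l : List Atom}
    (h : (l.map Atom.weight).sum ≤ 3 * r + 2) :
    ∃ m ∈ allMonomials r (l.map Atom.weight).sum, m.Perm l :=
  exists_mem_monomials (fun _ ha => mem_atoms
    ((List.single_le_sum (fun _ _ => Nat.zero_le _) _ (List.mem_map_of_mem ha)).trans h))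
    (Nat.lt_succ_self _)

/-! ### Monomials as exponent vectors and their weights. -/

/-- The exponents of a monomial. -/
noncomputable def exponents (l : List Atom) : Factor →₀ ℕ :=
  Multiset.toFinsupp (l.map Atom.toFactor : Multiset Factor)

theorem exponents_eq_of_perm {l m : List Atom} (h : l.Perm m) : exponents l = exponents m := by
  rw [exponents, exponents, Multiset.coe_eq_coe.2 (h.map _)]

theorem Atom.toFactor_surjective : Function.Surjective toFactor := by
  intro f
  rcases f with m | p
  · exact ⟨.u m, rfl⟩
  · induction p using Sym2.ind with
    | _ m n => exact ⟨.inner m n, toFactor_inner m n⟩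

theorem exponents_surjective : Function.Surjective exponents := by
  intro d
  obtain ⟨l, hl⟩ := Quot.exists_rep (Finsupp.toMultiset d)
  obtain ⟨l, rfl⟩ := (List.map_surjective_iff.2 Atom.toFactor_surjective) l
  refine ⟨l, ?_⟩
  rw [exponents, show ((l.map Atom.toFactor : List Factor) : Multiset Factor) =
    Finsupp.toMultiset d from hl, Finsupp.toMultiset_toFinsupp]

theorem Atom.weight_toFactor (a : Atom) :
    a.toFactor.weight (2 / 3) (1 / 3) = (a.weight : ℚ) / 3 := by
  cases a <;> simp [toFactor, Factor.weight, weight] <;> ring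

theorem weight_exponents (l : List Atom) :
    Finsupp.weight (Factor.weight (2 / 3) (1 / 3)) (exponents l) =
      ((l.map Atom.weight).sum : ℚ) / 3 := by
  induction l with
  | nil => simp [exponents]
  | cons a l ih =>
    have : exponents (a :: l) = Finsupp.single a.toFactor 1 + exponents l := by
      rw [exponents, List.map_cons, ← Multiset.cons_coe, ← Multiset.singleton_add, map_add,
        Multiset.toFinsupp_singleton]
      rfl
    rw [this, map_add, ih, Finsupp.weight_single, Atom.weight_toFactor, one_smul, List.map_cons,
      List.sum_cons, Nat.cast_add, add_div]

theorem sum_weight_of_coeff_ne_zero {P : ScalarExpr} {W : ℚ} {l : List Atom}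
    (hP : IsWeightedHomogeneous (Factor.weight (2 / 3) (1 / 3)) P W)
    (hl : coeff (exponents l) P ≠ 0) : ((l.map Atom.weight).sum : ℚ) = 3 * W := by
  have := hP hl
  rw [weight_exponents] at this
  linarith

/-- At most one entry of `L` is a permutation of `l`. If there is one, its parameter is the required
coefficient; if there is none, that coefficient is zero by `hl`. -/
theorem total_ansatz {ρ : ℕ → ℂ} {P : ScalarExpr} {L : List (List Atom)} {i : ℕ}
    (hL : L.Pairwise fun l m => ¬ l.Perm m)
    (hρ : ∀ j, j < L.length → ρ (i + j) = coeff (exponents (L.getD j [])) P) (l : List Atom)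
    (hl : coeff (exponents l) P ≠ 0 → ∃ m ∈ L, m.Perm l) :
    ((ansatz i L).termsAt l).total ρ = coeff (exponents l) P := by
  have none : ∀ {L : List (List Atom)} (i : ℕ), (∀ m ∈ L, ¬ m.Perm l) →
      ((ansatz i L).termsAt l).total ρ = 0 := by
    intro L
    induction L with
    | nil => simp [ansatz, Poly.termsAt, Poly.total]
    | cons m L ih =>
      intro i h
      have hm : m.isPerm l = false :=
        Bool.eq_false_iff.2 fun e => h m (by simp) (List.isPerm_iff.1 e)
      simpa [ansatz, Poly.termsAt, hm] using ih (i + 1) fun m' hm' => h m' (by simp [hm'])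
  induction L generalizing i with
  | nil =>
    have : coeff (exponents l) P = 0 := by
      by_contra h
      simpa using hl h
    simp [ansatz, Poly.termsAt, Poly.total, this]
  | cons m L ih =>
    rw [List.pairwise_cons] at hL
    by_cases hm : m.Perm l
    · have h0 := none (L := L) (i + 1) fun m' hm' h => hL.1 m' hm' (hm.trans h.symm)
      have h1 := hρ 0 (by simp)
      simp only [Poly.termsAt, Poly.total, ansatz] at h0 ⊢
      have hm' : m.isPerm l = true := List.isPerm_iff.2 hm
      simp only [List.filter_cons, hm', if_true, List.map_cons, List.sum_cons, h0]
      simpa [Term.const, exponents_eq_of_perm hm] using h1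
    · have := ih (i := i + 1) hL.2 (fun j hj => by
        have := hρ (j + 1) (by simpa using hj)
        rwa [show i + (j + 1) = i + 1 + j by ring, List.getD_cons_succ] at this)
        fun h => by
          obtain ⟨m', hm', h'⟩ := hl h
          rcases List.mem_cons.1 hm' with rfl | hm'
          · exact absurd h' hm
          · exact ⟨m', hm', h'⟩
      have hm : m.isPerm l = false := Bool.eq_false_iff.2 fun e => hm (List.isPerm_iff.1 e)
      simpa [ansatz, Poly.termsAt, hm] using this

theorem eval_ansatz {ρ : ℕ → ℂ} {P : ScalarExpr} {r i W : ℕ} (hr : (atoms r).Nodup)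
    (hW : W ≤ 3 * r + 2)
    (hP : IsWeightedHomogeneous (Factor.weight (2 / 3) (1 / 3)) P ((W : ℚ) / 3))
    (hρ : ∀ j, j < (allMonomials r W).length →
      ρ (i + j) = coeff (exponents ((allMonomials r W).getD j [])) P) :
    (ansatz i (allMonomials r W)).eval ρ (fun a => (X a.toFactor : ScalarExpr)) = P := by
  ext d
  obtain ⟨l, rfl⟩ := exponents_surjective d
  rw [exponents, coeff_eval, ← exponents]
  refine total_ansatz (pairwise_monomials _ _ hr) hρ l fun h => ?_
  have hl : (l.map Atom.weight).sum = W := by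
    have := sum_weight_of_coeff_ne_zero hP h
    rw [mul_div_cancel₀ _ (by norm_num)] at this
    exact_mod_cast this
  subst hl
  exact exists_mem_allMonomials hW

/-! ### Numbering of the unknown coefficients of a symmetry. -/

/-- The parameters of `T` as a homogeneous system of weight `r`, after the given parameters with
indices below 100. -/
noncomputable def paramsOf (a : ℕ → ℂ) (T : EvSystem) (r i : ℕ) : ℂ :=
  match i / 100 with
  | 0 => a i
  | 1 => coeff (exponents ((allMonomials r (3 * r + 2)).getD (i % 100) [])) T.scalar
  | k + 2 => coeff (exponents ((allMonomials r (3 * r - 3 * k)).getD (i % 100) [])) (T.vector k)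

/-- The lists of monomials are so short that the numbering of the parameters is unambiguous. -/
def IsSmall (r : ℕ) : Prop :=
  (atoms r).Nodup ∧ (allMonomials r (3 * r + 2)).length ≤ 100 ∧
    ∀ k ∈ List.range (r + 1), (allMonomials r (3 * r - 3 * k)).length ≤ 100

variable {a : ℕ → ℂ} {T : EvSystem} {r : ℕ}

theorem paramsOf_low {i : ℕ} (h : i < 100) : paramsOf a T r i = a i := by
  simp [paramsOf, Nat.div_eq_of_lt h]

theorem paramsOf_scalar {j : ℕ} (h : j < 100) : paramsOf a T r (100 + j) =
    coeff (exponents ((allMonomials r (3 * r + 2)).getD j [])) T.scalar := by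
  rw [paramsOf, show (100 + j) / 100 = 1 by omega, show (100 + j) % 100 = j by omega]

theorem paramsOf_vector {j k : ℕ} (h : j < 100) : paramsOf a T r (100 * (k + 2) + j) =
    coeff (exponents ((allMonomials r (3 * r - 3 * k)).getD j [])) (T.vector k) := by
  rw [paramsOf, show (100 * (k + 2) + j) / 100 = k + 2 by omega,
    show (100 * (k + 2) + j) % 100 = j by omega]

theorem toComponents_eval (ρ : ℕ → ℂ) (p : Poly) (N : ℕ) :
    ScalarExpr.toComponents N (p.eval ρ fun a => X a.toFactor) =
      p.eval ρ (Atom.toComponents N) := by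
  rw [ScalarExpr.toComponents, map_polyEval]
  congr 1
  ext1 a
  simp [Atom.toComponents]

/-- The coefficient would have the negative weight `r - k`, and monomials have non-negative weight.
-/
theorem EvSystem.IsHomogeneous.vector_eq_zero (hT : T.IsHomogeneous (2 / 3) (1 / 3) r) {k : ℕ}
    (hk : r < k) : T.vector k = 0 := by
  ext d
  obtain ⟨l, rfl⟩ := exponents_surjective d
  rw [coeff_zero]
  by_contra h
  have h1 := sum_weight_of_coeff_ne_zero (hT.2 k) h
  have h2 : (r : ℚ) < k := by exact_mod_cast hk
  have h3 : (0 : ℚ) ≤ (l.map Atom.weight).sum := Nat.cast_nonneg _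
  linarith

theorem EvSystem.IsHomogeneous.isGivenBy (hT : T.IsHomogeneous (2 / 3) (1 / 3) r)
    (hr : IsSmall r) : T.IsGivenBy (paramsOf a T r) (scalarAnsatz r) (vectorAnsatz r) := by
  have hs : (scalarAnsatz r).eval (paramsOf a T r) (fun a => X a.toFactor) = T.scalar := by
    refine eval_ansatz hr.1 le_rfl ?_ fun j hj => paramsOf_scalar (hj.trans_le hr.2.1)
    convert hT.1 using 1
    push_cast
    ring
  have hv : ∀ k < r + 1, (ansatz (100 * (k + 2)) (allMonomials r (3 * r - 3 * k))).eval
      (paramsOf a T r) (fun a => X a.toFactor) = T.vector k := by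
    intro k hk
    refine eval_ansatz hr.1 (by omega) ?_ fun j hj =>
      paramsOf_vector (hj.trans_le (hr.2.2 k (List.mem_range.2 hk)))
    convert hT.2 k using 1
    push_cast [show 3 * k ≤ 3 * r by omega]
    ring
  refine ⟨fun N => ?_, fun N j => ?_⟩
  · rw [← toComponents_eval, hs, rhs]
  · have hsub : T.vector.support ⊆ Finset.range (r + 1) := fun k hk => by
      by_contra h
      exact Finsupp.mem_support_iff.1 hk
        (hT.vector_eq_zero (by simpa [Nat.lt_succ_iff] using h))
    rw [rhs, Finsupp.sum_of_support_subset _ hsub _ fun k _ => by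
      simp [ScalarExpr.toComponents], vectorAnsatz, VPoly.eval_flatMap,
      ← List.sum_toFinset _ List.nodup_range, List.toFinset_range]
    refine Finset.sum_congr rfl fun k hk => ?_
    rw [VPoly.eval_map_pair, ← hv k (Finset.mem_range.1 hk), toComponents_eval]

/-- An atom of order `r` has weight at least `r + 2/3`, which is the whole weight of the scalar
equation, with equality only for `∂ₓʳu` and `⟨U, ∂ₓʳU⟩`. The coefficients in the vector equation are
too light to contain such an atom, and that of `∂ₓʳU` has weight zero, hence is constant. -/
theorem EvSystem.IsHomogeneous.leading_ne_zero (hT : T.IsHomogeneous (2 / 3) (1 / 3) r)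
    (h : T.InvolvesOrder r) : coeff (exponents [.u r]) T.scalar ≠ 0 ∨
      coeff (exponents [.dot 0 r]) T.scalar ≠ 0 ∨ coeff (exponents []) (T.vector r) ≠ 0 := by
  have key : ∀ {P : ScalarExpr} {W : ℚ},
      IsWeightedHomogeneous (Factor.weight (2 / 3) (1 / 3)) P W → (∃ f ∈ P.vars, f.order = r) →
      ∃ (b : Atom) (l : List Atom), b.toFactor.order = r ∧ coeff (exponents (b :: l)) P ≠ 0 := by
    rintro P W - ⟨f, hf, hfr⟩
    obtain ⟨d, hd, hfd⟩ := (mem_vars_iff_mem_support _).1 hf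
    obtain ⟨l, rfl⟩ := exponents_surjective d
    obtain ⟨b, rfl⟩ := Atom.toFactor_surjective f
    have hb : b ∈ l := by
      rw [exponents, Finsupp.mem_support_iff, Multiset.toFinsupp_apply, Multiset.count_ne_zero,
        Multiset.mem_coe, List.mem_map] at hfd
      obtain ⟨c, hc, e⟩ := hfd
      exact Atom.toFactor_injective e ▸ hc
    refine ⟨b, l.erase b, hfr, ?_⟩
    rw [← exponents_eq_of_perm (List.perm_cons_erase hb)]
    exact mem_support_iff.1 hd
  have hw : ∀ b : Atom, b.toFactor.order = r → 3 * r + 2 ≤ b.weight ∧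
      (b.weight = 3 * r + 2 → b = .u r ∨ b = .dot 0 r) := by
    rintro (m | ⟨m, e⟩) h
    · obtain rfl : m = r := h
      simp [Atom.weight]
      omega
    · have h : max m (m + e) = r := h
      rw [max_eq_right (Nat.le_add_right m e)] at h
      subst h
      simp [Atom.weight]
      omega
  rcases h with h | h | ⟨k, h⟩
  · obtain ⟨b, l, hb, hc⟩ := key hT.1 h
    have h1 := sum_weight_of_coeff_ne_zero hT.1 hc
    have h2 : ((b :: l).map Atom.weight).sum = 3 * r + 2 := by
      have : (((b :: l).map Atom.weight).sum : ℚ) = (3 * r + 2 : ℕ) := by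
        rw [h1]; push_cast; ring
      exact_mod_cast this
    rw [List.map_cons, List.sum_cons] at h2
    obtain rfl : l = [] := by
      cases l with
      | nil => rfl
      | cons c l =>
        have := c.two_le_weight
        have := (hw b hb).1
        rw [List.map_cons, List.sum_cons] at h2
        omega
    rcases (hw b hb).2 (by simpa using h2) with rfl | rfl
    · exact .inl hc
    · exact .inr (.inl hc)
  · obtain ⟨d, hd⟩ := MvPolynomial.ne_zero_iff.1 h
    obtain ⟨l, rfl⟩ := exponents_surjective d
    have h1 := sum_weight_of_coeff_ne_zero (hT.2 r) hd
    rw [sub_self, mul_zero] at h1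
    obtain rfl : l = [] := by
      cases l with
      | nil => rfl
      | cons c l =>
        have := c.two_le_weight
        rw [List.map_cons, List.sum_cons] at h1
        have : c.weight + (l.map Atom.weight).sum = 0 := by exact_mod_cast h1
        omega
    exact .inr (.inr hd)
  -- This case is void, since `3r + 2 ≤ 3(r - k)` cannot hold.
  · obtain ⟨b, l, hb, hc⟩ := key (hT.2 k) h
    have h1 := sum_weight_of_coeff_ne_zero (hT.2 k) hc
    have h2 : ((3 * r + 2 : ℕ) : ℚ) ≤ ((b :: l).map Atom.weight).sum := by
      rw [List.map_cons, List.sum_cons]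
      exact_mod_cast (hw b hb).1.trans (Nat.le_add_right _ _)
    rw [h1] at h2
    push_cast at h2
    have h3 : (0 : ℚ) ≤ k := Nat.cast_nonneg k
    linarith

/-! ### The second order systems -/

/-- The scalar part of the second order systems; the parameter with index `i` is `aᵢ`. -/
def secondOrderScalar : Poly :=
  [⟨1, [1], [.u 2]⟩, ⟨1, [2], [.u 0, .u 0, .u 0, .u 0]⟩, ⟨1, [3], [.dot 0 2]⟩,
    ⟨1, [4], [.dot 1 0]⟩, ⟨1, [5], [.u 0, .u 0, .u 0, .dot 0 0]⟩,
    ⟨1, [6], [.u 0, .u 0, .dot 0 0, .dot 0 0]⟩, ⟨1, [7], [.u 0, .dot 0 0, .dot 0 0, .dot 0 0]⟩,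
    ⟨1, [8], [.dot 0 0, .dot 0 0, .dot 0 0, .dot 0 0]⟩]

/-- The vector part of the second order systems; the parameter with index `i` is `aᵢ`. -/
def secondOrderVector : VPoly :=
  [(⟨1, [9], []⟩, 2), (⟨1, [10], [.u 0, .u 0, .u 0]⟩, 0), (⟨1, [11], [.u 0, .u 0, .dot 0 0]⟩, 0),
    (⟨1, [12], [.u 0, .dot 0 0, .dot 0 0]⟩, 0), (⟨1, [13], [.dot 0 0, .dot 0 0, .dot 0 0]⟩, 0)]

/-- The coefficients as a sequence. -/
def Coeffs.toFun (a : Coeffs) : ℕ → ℂ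
  | 1 => a.a₁ | 2 => a.a₂ | 3 => a.a₃ | 4 => a.a₄ | 5 => a.a₅ | 6 => a.a₆ | 7 => a.a₇
  | 8 => a.a₈ | 9 => a.a₉ | 10 => a.a₁₀ | 11 => a.a₁₁ | 12 => a.a₁₂ | 13 => a.a₁₃ | _ => 0

theorem vector_rhs_single_add_single (s : ScalarExpr) (P Q : ScalarExpr) (i j : ℕ) (N : ℕ)
    (n : Fin N) : EvSystem.rhs ⟨s, smulU P i + smulU Q j⟩ N (some n) =
      ScalarExpr.toComponents N P * X (some n, i) +
        ScalarExpr.toComponents N Q * X (some n, j) := by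
  rw [EvSystem.rhs, Finsupp.sum_add_index', smulU, smulU, Finsupp.sum_single_index,
    Finsupp.sum_single_index]
  all_goals simp [ScalarExpr.toComponents, add_mul]

theorem Coeffs.isGivenBy_system (a : Coeffs) {ρ : ℕ → ℂ} (h : ∀ i < 100, ρ i = a.toFun i) :
    a.system.IsGivenBy ρ secondOrderScalar secondOrderVector := by
  have hd : ∀ N m n, ScalarExpr.toComponents N (dotU m n) = (Atom.inner m n).toComponents N :=
    fun N m n => by
      rw [Atom.toComponents, Atom.toFactor_inner]; simp [ScalarExpr.toComponents, dotU]
  have hu : ∀ N m, ScalarExpr.toComponents N (du m) = (Atom.u m).toComponents N :=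
    fun N m => by simp [ScalarExpr.toComponents, du, Atom.toComponents, Atom.toFactor]
  have hC : ∀ N c, ScalarExpr.toComponents N (C c) = algebraMap ℂ _ c := fun N c => by
    simp [ScalarExpr.toComponents]
  have hadd : ∀ N P Q, ScalarExpr.toComponents N (P + Q) =
    ScalarExpr.toComponents N P + ScalarExpr.toComponents N Q := fun N => map_add _
  have hmul : ∀ N P Q, ScalarExpr.toComponents N (P * Q) =
    ScalarExpr.toComponents N P * ScalarExpr.toComponents N Q := fun N => map_mul _
  have hpow : ∀ N P k, ScalarExpr.toComponents N (P ^ k) =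
    ScalarExpr.toComponents N P ^ k := fun N => map_pow _
  refine ⟨fun N => ?_, fun N j => ?_⟩
  · simp only [EvSystem.rhs, Coeffs.system, hadd, hmul, hpow, hC, hd, hu, secondOrderScalar,
      Poly.eval_cons, Poly.eval_nil, Term.eval, Term.const, List.map_cons, List.map_nil,
      List.prod_cons, List.prod_nil, Int.cast_one, one_mul, mul_one, h, Nat.reduceLT, Coeffs.toFun]
    simp only [Atom.inner, Nat.ble, cond_true, Nat.reduceSub]
    ring
  · simp only [Coeffs.system]
    rw [vector_rhs_single_add_single]
    simp only [hadd, hmul, hpow, hC, hd, hu, secondOrderVector,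
      VPoly.eval_cons, VPoly.eval_nil, Term.eval, Term.const, List.map_cons, List.map_nil,
      List.prod_cons, List.prod_nil, Int.cast_one, one_mul, mul_one, h, Nat.reduceLT, Coeffs.toFun]
    simp only [Atom.inner, Nat.ble, cond_true, Nat.reduceSub]
    ring

/-! ### Equations for the coefficients, verified by evaluation. -/

/-- All coefficients vanish after collection of the terms with the same parameters. -/
def Poly.vanishes (p : Poly) : Bool :=
  (collect (p.map fun t => ⟨t.coeff, t.params, []⟩)).all fun t => t.coeff == 0

/-- `total` ignores monomials, so they are emptied before like terms are collected. The test then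
amounts to a polynomial identity in the parameters, valid for every `ρ`. -/
theorem Poly.total_eq_zero_of_vanishes {ρ : ℕ → ℂ} {p : Poly} (h : p.vanishes = true) :
    p.total ρ = 0 := by
  have h1 : p.total ρ =
      Poly.eval ρ (fun _ => (1 : ℂ)) (p.map fun t => (⟨t.coeff, t.params, []⟩ : Term)) := by
    simp [total, eval, Function.comp_def, Term.eval, Term.const]
    rfl
  rw [h1, ← eval_collect, eval]
  refine List.sum_eq_zero fun x hx => ?_
  obtain ⟨t, ht, rfl⟩ := List.mem_map.1 hx
  have := List.all_eq_true.1 h t ht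
  simp [Term.eval, Term.const, eq_of_beq this]

theorem Poly.total_append (ρ : ℕ → ℂ) (p q : Poly) : (p ++ q).total ρ = p.total ρ + q.total ρ := by
  simp [total]

theorem Poly.total_neg (ρ : ℕ → ℂ) (p : Poly) : p.neg.total ρ = -p.total ρ := by
  induction p with
  | nil => simp [neg, mulTerm, total]
  | cons t p ih =>
    simp [neg, mulTerm, total, Term.mul, Term.const] at ih ⊢
    linear_combination ih

/-- The listed coefficients of the scalar part of the commutator of the second order systems with
the general system of weight `r` are as stated. -/
def checkScalar (r : ℕ) (L : List (List Atom × Poly)) : Bool :=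
  L.all fun e => Poly.vanishes (commScalarAt e.1 secondOrderScalar secondOrderVector
    (scalarAnsatz r) (vectorAnsatz r) ++ e.2.neg)

/-- The listed coefficients of the vector part of the commutator of the second order systems with
the general system of weight `r` are as stated. -/
def checkVector (r : ℕ) (L : List ((List Atom × ℕ) × Poly)) : Bool :=
  L.all fun e => Poly.vanishes (commVectorAt e.1.1 e.1.2 secondOrderScalar secondOrderVector
    (scalarAnsatz r) (vectorAnsatz r) ++ e.2.neg)

section

variable {a : Coeffs} {T : EvSystem} {r : ℕ}

/-- The check shows that each listed polynomial equals a coefficient of the commutator identically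
in the parameters; for the parameters of a symmetry that coefficient is zero. -/
theorem EvSystem.IsSymmetry.scalar_equations (hT : a.system.IsSymmetry T r) (hr : IsSmall r)
    {L : List (List Atom × Poly)} (hL : checkScalar r L = true) :
    ∀ e ∈ L, e.2.total (paramsOf a.toFun T r) = 0 := by
  intro e he
  have h1 := Poly.total_eq_zero_of_vanishes (ρ := paramsOf a.toFun T r)
    (List.all_eq_true.1 hL e he)
  rw [Poly.total_append, Poly.total_neg, ← termsAt_commScalar,
    (a.isGivenBy_system fun i hi => paramsOf_low hi).total_commScalar
      (hT.homogeneous.isGivenBy hr) hT.commutes, zero_add, neg_eq_zero] at h1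
  exact h1

theorem EvSystem.IsSymmetry.vector_equations (hT : a.system.IsSymmetry T r) (hr : IsSmall r)
    {L : List ((List Atom × ℕ) × Poly)} (hL : checkVector r L = true) :
    ∀ e ∈ L, e.2.total (paramsOf a.toFun T r) = 0 := by
  intro e he
  have h1 := Poly.total_eq_zero_of_vanishes (ρ := paramsOf a.toFun T r)
    (List.all_eq_true.1 hL e he)
  rw [Poly.total_append, Poly.total_neg, ← termsAt_commVector,
    (a.isGivenBy_system fun i hi => paramsOf_low hi).total_commVector
      (hT.homogeneous.isGivenBy hr) hT.commutes, zero_add, neg_eq_zero] at h1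
  exact h1

theorem isSmall_four : IsSmall 4 := by
  unfold IsSmall
  decide +kernel

theorem isSmall_three : IsSmall 3 := by
  unfold IsSmall
  decide +kernel

end

/-! ### Systems with `U_xx` in the equation for `U` -/

/-- Coefficients of terms quadratic in `U` in the scalar part of the commutator. -/
def quadraticRows : List (List Atom × Poly) :=
  [([.dot 0 6], [⟨1, [102, 1], []⟩, ⟨-1, [102, 9], []⟩, ⟨-1, [107, 3], []⟩, ⟨1, [600, 3], []⟩]),
    ([.dot 1 4], [⟨2, [102, 1], []⟩, ⟨1, [101, 1], []⟩, ⟨-1, [101, 9], []⟩, ⟨-4, [107, 3], []⟩,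
      ⟨-2, [107, 4], []⟩, ⟨2, [600, 4], []⟩]),
    ([.dot 3 0], [⟨1, [101, 1], []⟩, ⟨-1, [101, 9], []⟩, ⟨2, [100, 1], []⟩, ⟨-4, [107, 3], []⟩,
      ⟨-6, [107, 4], []⟩])]

theorem checkScalar_quadraticRows : checkScalar 4 quadraticRows = true := by
  decide +kernel

/-- Coefficients of the vector part of the commutator that decide the case in which `U_t` contains
`U_xx`. -/
def diffusiveRows : List ((List Atom × ℕ) × Poly) :=
  [(([.u 0, .u 0, .u 1], 3), [⟨6, [403, 9], []⟩, ⟨-12, [600, 10], []⟩]),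
    (([.u 0, .u 1, .u 1], 2), [⟨6, [403, 9], []⟩, ⟨4, [305, 9], []⟩, ⟨-36, [600, 10], []⟩]),
    (([.u 0, .u 0, .u 2], 2), [⟨-3, [403, 1], []⟩, ⟨3, [403, 9], []⟩, ⟨2, [305, 9], []⟩,
      ⟨-18, [600, 10], []⟩]),
    (([.u 0, .u 0, .u 3], 1), [⟨-1, [305, 1], []⟩, ⟨1, [305, 9], []⟩, ⟨2, [217, 9], []⟩,
      ⟨-12, [600, 10], []⟩]),
    (([.u 0, .u 0, .u 4], 0), [⟨3, [107, 10], []⟩, ⟨-1, [217, 1], []⟩, ⟨1, [217, 9], []⟩,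
      ⟨-3, [600, 10], []⟩]),
    (([.dot 0 0, .u 0, .u 1], 3), [⟨4, [402, 9], []⟩, ⟨-8, [600, 11], []⟩]),
    (([.dot 0 0, .u 1, .u 1], 2), [⟨2, [402, 9], []⟩, ⟨2, [303, 9], []⟩, ⟨-12, [600, 11], []⟩]),
    (([.dot 0 0, .u 0, .u 3], 1), [⟨-1, [303, 1], []⟩, ⟨1, [303, 9], []⟩, ⟨2, [211, 9], []⟩,
      ⟨-8, [600, 11], []⟩]),
    (([.dot 0 0, .u 0, .u 4], 0), [⟨2, [107, 11], []⟩, ⟨-1, [211, 1], []⟩, ⟨1, [211, 9], []⟩,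
      ⟨-2, [600, 11], []⟩]),
    (([.dot 0 2, .u 0, .u 0], 2), [⟨2, [304, 9], []⟩, ⟨-3, [403, 3], []⟩, ⟨-12, [600, 11], []⟩]),
    (([.dot 0 1, .u 0, .u 1], 2), [⟨8, [402, 9], []⟩, ⟨4, [303, 9], []⟩, ⟨4, [304, 9], []⟩,
      ⟨-48, [600, 11], []⟩]),
    (([.dot 0 0, .dot 0 0, .u 1], 3), [⟨2, [401, 9], []⟩, ⟨-4, [600, 12], []⟩]),
    (([.dot 0 0, .dot 0 2, .u 0], 2), [⟨2, [302, 9], []⟩, ⟨-2, [402, 3], []⟩,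
      ⟨-24, [600, 12], []⟩]),
    (([.dot 0 1, .dot 0 1, .u 0], 2), [⟨8, [401, 9], []⟩, ⟨4, [302, 9], []⟩, ⟨-48, [600, 12], []⟩]),
    (([.dot 0 0, .dot 0 0, .u 2], 2), [⟨-1, [401, 1], []⟩, ⟨1, [401, 9], []⟩, ⟨2, [301, 9], []⟩,
      ⟨-6, [600, 12], []⟩]),
    (([.dot 0 0, .dot 0 0, .u 3], 1), [⟨-1, [301, 1], []⟩, ⟨1, [301, 9], []⟩, ⟨2, [204, 9], []⟩,
      ⟨-4, [600, 12], []⟩]),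
    (([.dot 0 0, .dot 0 0, .u 4], 0), [⟨1, [107, 12], []⟩, ⟨-1, [204, 1], []⟩, ⟨1, [204, 9], []⟩,
      ⟨-1, [600, 12], []⟩]),
    (([.dot 0 0, .dot 0 0, .dot 0 1], 3), [⟨12, [400, 9], []⟩, ⟨-24, [600, 13], []⟩]),
    (([.dot 0 0, .dot 0 1, .dot 0 1], 2), [⟨24, [400, 9], []⟩, ⟨8, [300, 9], []⟩,
      ⟨-144, [600, 13], []⟩]),
    (([.dot 0 0, .dot 0 0, .dot 0 2], 2), [⟨2, [300, 9], []⟩, ⟨-1, [401, 3], []⟩,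
      ⟨-36, [600, 13], []⟩]),
    (([.u 0, .u 0, .u 0, .u 0, .u 0, .u 0], 2), [⟨-3, [403, 2], []⟩]),
    (([.dot 0 0, .u 0, .u 0, .u 0, .u 0, .u 0], 2), [⟨-2, [402, 10], []⟩, ⟨-2, [402, 2], []⟩,
      ⟨-3, [403, 5], []⟩]),
    (([.dot 0 0, .dot 0 0, .u 0, .u 0, .u 0, .u 0], 2), [⟨-4, [401, 10], []⟩, ⟨-1, [401, 2], []⟩,
      ⟨-2, [402, 11], []⟩, ⟨-2, [402, 5], []⟩, ⟨-3, [403, 6], []⟩]),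
    (([.dot 0 0, .dot 0 0, .dot 0 0, .u 0, .u 0, .u 0], 2), [⟨-6, [400, 10], []⟩,
      ⟨-4, [401, 11], []⟩, ⟨-1, [401, 5], []⟩, ⟨-2, [402, 12], []⟩, ⟨-2, [402, 6], []⟩,
      ⟨-3, [403, 7], []⟩]),
    (([.dot 0 0, .dot 0 0, .dot 0 0, .dot 0 0, .u 0, .u 0], 2), [⟨-6, [400, 11], []⟩,
      ⟨-4, [401, 12], []⟩, ⟨-1, [401, 6], []⟩, ⟨-2, [402, 13], []⟩, ⟨-2, [402, 7], []⟩,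
      ⟨-3, [403, 8], []⟩])]

theorem checkVector_diffusiveRows : checkVector 4 diffusiveRows = true := by
  decide +kernel

section

variable {ρ : ℕ → ℂ}

/-- In the application `ρ 1`, …, `ρ 13` are the `aᵢ`; for the symmetry, `ρ 107`, `ρ 102`, `ρ 101`
multiply `∂ₓ⁴u`, `⟨U, ∂ₓ⁴U⟩`, `⟨∂ₓU, ∂ₓ³U⟩` in the scalar equation and `ρ 600` multiplies `∂ₓ⁴U`. If
`ρ 102` were the only non-zero leading coefficient, the first row would give `a₁ = a₉` and the
second `a₁ = 0`. -/
theorem leading_eq_zero_of_quadraticRows (h : ∀ e ∈ quadraticRows, e.2.total ρ = 0)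
    (h₀ : ρ 1 ≠ 0 ∨ ρ 9 ≠ 0) (h₁ : ρ 107 = 0) (h₂ : ρ 600 = 0) : ρ 102 = 0 := by
  simp only [quadraticRows, List.forall_mem_cons, Poly.total, Term.const,
    List.map_cons, List.map_nil, List.sum_cons, List.sum_nil, List.prod_cons, List.prod_nil,
    Int.cast_neg, Int.cast_one, Int.cast_ofNat, mul_one, one_mul, add_zero] at h
  obtain ⟨e1, e2, -⟩ := h
  rw [h₁, h₂] at e1 e2
  by_contra hc
  have h : ρ 1 = ρ 9 := mul_left_cancel₀ hc (by linear_combination e1)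
  rw [h] at e2 h₀
  exact mul_ne_zero hc (or_self_iff.1 h₀) (by linear_combination e2 / 2)

/-- The guiding picture is `U_t = LU` with `L = a₉∂ₓ² + f` and a symmetry proportional to `L²U`. The
rows yield the coefficient `2kf` of `∂ₓ²U`; comparison of the lower coefficients makes `f` a
multiple of `(u + l⟨U, U⟩)³`. The last five rows say that the part without `x`-derivatives of the
time derivative of `2kf` vanishes. -/
theorem diffusive_coeffs (hs : ∀ e ∈ quadraticRows, e.2.total ρ = 0)
    (hv : ∀ e ∈ diffusiveRows, e.2.total ρ = 0) (h₉ : ρ 9 ≠ 0)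
    (hu : ρ 10 ≠ 0 ∨ ρ 11 ≠ 0 ∨ ρ 12 ≠ 0) (hl : ρ 107 ≠ 0 ∨ ρ 102 ≠ 0 ∨ ρ 600 ≠ 0) :
    ∃ l, ρ 10 ≠ 0 ∧ ρ 1 = 0 ∧ ρ 2 = 0 ∧ ρ 3 = -2 * l * ρ 9 ∧ ρ 4 = 0 ∧
      ρ 5 = -2 * l * ρ 10 ∧ ρ 6 = -6 * l ^ 2 * ρ 10 ∧ ρ 7 = -6 * l ^ 3 * ρ 10 ∧
      ρ 8 = -2 * l ^ 4 * ρ 10 ∧ ρ 11 = 3 * l * ρ 10 ∧ ρ 12 = 3 * l ^ 2 * ρ 10 ∧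
      ρ 13 = l ^ 3 * ρ 10 := by
  have hlin := leading_eq_zero_of_quadraticRows hs (.inr h₉)
  simp only [diffusiveRows, quadraticRows, List.forall_mem_cons, Poly.total, Term.const,
    List.map_cons, List.map_nil, List.sum_cons, List.sum_nil, List.prod_cons, List.prod_nil,
    Int.cast_neg, Int.cast_one, Int.cast_ofNat, mul_one, one_mul, add_zero] at hv hs
  obtain ⟨e1, e2, e3, e4, e5, e6, e7, e8, e9, e10, e11, e12, e13, e14, e15, e16, e17, e18, e19, e20, e21, e22, e23, e24, e25, -⟩ := hv
  obtain ⟨-, s1, s2, -⟩ := hs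
  obtain ⟨k, hk⟩ : ∃ k, ρ 600 = k * ρ 9 := ⟨ρ 600 / ρ 9, by field_simp⟩
  -- This value of `l` is the one for which `u + l⟨U, U⟩` can be conserved.
  obtain ⟨l, h3⟩ : ∃ l, ρ 3 = -2 * l * ρ 9 := ⟨-ρ 3 / (2 * ρ 9), by field_simp⟩
  have q1 : ρ 403 = 2 * k * ρ 10 :=
    mul_right_cancel₀ h₉ (by linear_combination e1 / 6 + 2 * ρ 10 * hk)
  have r1 : ρ 402 = 2 * k * ρ 11 :=
    mul_right_cancel₀ h₉ (by linear_combination e6 / 4 + 2 * ρ 11 * hk)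
  have t1 : ρ 401 = 2 * k * ρ 12 :=
    mul_right_cancel₀ h₉ (by linear_combination e12 / 2 + 2 * ρ 12 * hk)
  have p1 : ρ 400 = 2 * k * ρ 13 :=
    mul_right_cancel₀ h₉ (by linear_combination e18 / 12 + 2 * ρ 13 * hk)
  simp only [hk, h3, q1, r1] at e2 e3 e4 e5 e7 e8 e9 e10 e11 e13
  simp only [hk, h3, q1, r1, t1, p1] at e14 e15 e16 e17 e19 e20 e21 e22 e23 e24 e25 s1 s2
  have q2 : ρ 305 = 6 * k * ρ 10 := mul_right_cancel₀ h₉ (by linear_combination e2 / 4)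
  have r2 : ρ 303 = 4 * k * ρ 11 := mul_right_cancel₀ h₉ (by linear_combination e7 / 2)
  have s : ρ 304 = 6 * k * ρ 11 - 6 * k * l * ρ 10 :=
    mul_right_cancel₀ h₉ (by linear_combination e10 / 2)
  have t2 : ρ 302 = 12 * k * ρ 12 - 4 * k * l * ρ 11 :=
    mul_right_cancel₀ h₉ (by linear_combination e13 / 2)
  have p2 : ρ 300 = 18 * k * ρ 13 - 2 * k * l * ρ 12 :=
    mul_right_cancel₀ h₉ (by linear_combination e20 / 2)
  simp only [q2, r2, s, t2, p2] at e3 e4 e8 e11 e14 e19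
  -- For `k = 0` the rows force `ρ 107 = 0`, and `hlin` then removes the last possible leading
  -- coefficient.
  have hk0 : k ≠ 0 := by
    rintro rfl
    have q3 : ρ 217 = 0 := mul_right_cancel₀ h₉ (by linear_combination e4 / 2)
    have r3 : ρ 211 = 0 := mul_right_cancel₀ h₉ (by linear_combination e8 / 2)
    have t : ρ 301 = 0 := mul_right_cancel₀ h₉ (by linear_combination e15 / 2)
    have t3 : ρ 204 = 0 := mul_right_cancel₀ h₉ (by
      linear_combination e16 / 2 + ρ 1 * t / 2 - ρ 9 * t / 2)
    have b : ρ 107 = 0 := by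
      rcases hu with h | h | h
      · exact mul_right_cancel₀ h (by linear_combination e5 / 3 + (ρ 1 - ρ 9) / 3 * q3)
      · exact mul_right_cancel₀ h (by linear_combination e9 / 2 + (ρ 1 - ρ 9) / 2 * r3)
      · exact mul_right_cancel₀ h (by linear_combination e17 + (ρ 1 - ρ 9) * t3)
    have hb : ρ 600 = 0 := by rw [hk, zero_mul]
    simp [b, hb, hlin b hb] at hl
  have h11 : ρ 11 = 3 * l * ρ 10 :=
    mul_left_cancel₀ (mul_ne_zero hk0 h₉) (by linear_combination e11 / 8)
  have h12 : ρ 12 = l * ρ 11 :=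
    mul_left_cancel₀ (mul_ne_zero hk0 h₉) (by linear_combination e14 / 16)
  have h13 : ρ 13 = l * ρ 12 / 3 :=
    mul_left_cancel₀ (mul_ne_zero hk0 h₉) (by linear_combination e19 / 48)
  have h10 : ρ 10 ≠ 0 := by
    intro h
    simp [h12, h11, h] at hu
  -- This is three times the coefficient of `u³∂ₓ²U` in the symmetry. Its time derivative isolates
  -- `a₁`, `a₂` and, successively, `a₅`, …, `a₈`.
  have hq : 3 * (2 * k * ρ 10) ≠ 0 := by simp [hk0, h10]
  have h1 : ρ 1 = 0 := mul_left_cancel₀ hq (by linear_combination -e3)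
  have h2 : ρ 2 = 0 := mul_left_cancel₀ hq (by linear_combination -e21)
  have b : ρ 107 = 0 := by
    have q3 : ρ 217 = 3 * k * ρ 10 := mul_right_cancel₀ h₉ (by
      linear_combination e4 / 2 + 3 * k * ρ 10 * h1)
    refine mul_right_cancel₀ h10 ?_
    rw [q3, h1] at e5
    linear_combination e5 / 3
  have c : ρ 101 = 0 := by
    rw [b, h1] at s2
    exact mul_right_cancel₀ h₉ (by linear_combination -s2)
  have h4 : ρ 4 = 0 := by
    rw [b, c, h1] at s1
    exact mul_left_cancel₀ (mul_ne_zero hk0 h₉) (by linear_combination s1 / 2)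
  simp only [h11, h12, h13] at e22 e23 e24 e25 ⊢
  have h5 : ρ 5 = -2 * l * ρ 10 := mul_left_cancel₀ hq (by
    linear_combination -e22 - 12 * k * l * ρ 10 * h2)
  have h6 : ρ 6 = -6 * l ^ 2 * ρ 10 := by
    rw [h5, h2] at e23
    exact mul_left_cancel₀ hq (by linear_combination -e23)
  have h7 : ρ 7 = -6 * l ^ 3 * ρ 10 := by
    rw [h5, h6] at e24
    exact mul_left_cancel₀ hq (by linear_combination -e24)
  refine ⟨l, h10, h1, h2, h3, h4, h5, h6, h7, ?_, rfl, by ring, by ring⟩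
  rw [h7, h6] at e25
  exact mul_left_cancel₀ hq (by linear_combination -e25)

end

/-! ### Systems without `u_xx` and `U_xx` in the leading diagonal -/

/-- A coefficient of the scalar part of the commutator that excludes `a₁ = a₉ = 0`. -/
def nilpotentScalarRows : List (List Atom × Poly) :=
  [([.dot 0 0, .dot 0 0, .dot 0 1, .u 3], [⟨12, [108, 1], []⟩, ⟨-20, [102, 12], []⟩,
      ⟨-1, [101, 12], []⟩, ⟨-24, [107, 7], []⟩, ⟨1, [301, 3], []⟩, ⟨10, [204, 3], []⟩,
      ⟨2, [204, 4], []⟩, ⟨1, [205, 3], []⟩])]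

theorem checkScalar_nilpotentScalarRows : checkScalar 4 nilpotentScalarRows = true := by
  decide +kernel

/-- Coefficients of the vector part of the commutator that exclude `a₁ = a₉ = 0`. -/
def nilpotentVectorRows : List ((List Atom × ℕ) × Poly) :=
  [(([.dot 0 2, .u 0, .u 2], 0), [⟨2, [212, 9], []⟩, ⟨-2, [215, 1], []⟩, ⟨2, [215, 9], []⟩,
      ⟨-2, [217, 3], []⟩, ⟨-24, [600, 11], []⟩]),
    (([.dot 0 4, .u 0, .u 0], 0), [⟨3, [102, 10], []⟩, ⟨-1, [217, 3], []⟩]),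
    (([.dot 0 0, .dot 0 2, .u 2], 0), [⟨2, [205, 9], []⟩, ⟨-1, [209, 1], []⟩, ⟨1, [209, 9], []⟩,
      ⟨-1, [211, 3], []⟩, ⟨-24, [600, 12], []⟩]),
    (([.dot 0 0, .dot 0 4, .u 0], 0), [⟨2, [102, 11], []⟩, ⟨-1, [211, 3], []⟩]),
    (([.dot 0 0, .dot 0 0, .dot 0 4], 0), [⟨1, [102, 12], []⟩, ⟨-1, [204, 3], []⟩]),
    (([.dot 0 0, .dot 0 0, .dot 1 2], 0), [⟨1, [101, 12], []⟩, ⟨2, [202, 9], []⟩,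
      ⟨-2, [204, 3], []⟩, ⟨-2, [204, 4], []⟩, ⟨-24, [600, 13], []⟩]),
    (([.dot 0 0, .dot 0 0, .dot 0 3], 1), [⟨2, [202, 9], []⟩, ⟨-1, [301, 3], []⟩,
      ⟨-24, [600, 13], []⟩]),
    (([.dot 0 0, .dot 0 1, .dot 0 3], 0), [⟨8, [202, 9], []⟩, ⟨-1, [205, 3], []⟩,
      ⟨-96, [600, 13], []⟩])]

theorem checkVector_nilpotentVectorRows : checkVector 4 nilpotentVectorRows = true := by
  decide +kernel

section

variable {ρ : ℕ → ℂ}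

/-- If `a₁ = a₉ = 0`, then `a₃ ≠ 0` and the quadratic rows give `ρ 600 = ρ 107 = 0`, so `ρ 102 ≠ 0`.
The remaining rows show that `ρ 102` annihilates each of `a₁₀`, `a₁₁`, `a₁₂`, against the coupling
assumption. -/
theorem diagonal_ne_zero (hq : ∀ e ∈ quadraticRows, e.2.total ρ = 0)
    (hs : ∀ e ∈ nilpotentScalarRows, e.2.total ρ = 0)
    (hv : ∀ e ∈ nilpotentVectorRows, e.2.total ρ = 0) (h₃ : ρ 1 ≠ 0 ∨ ρ 3 ≠ 0 ∨ ρ 9 ≠ 0)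
    (hu : ρ 10 ≠ 0 ∨ ρ 11 ≠ 0 ∨ ρ 12 ≠ 0) (hl : ρ 107 ≠ 0 ∨ ρ 102 ≠ 0 ∨ ρ 600 ≠ 0) :
    ρ 1 ≠ 0 ∨ ρ 9 ≠ 0 := by
  by_contra! h
  obtain ⟨h1, h9⟩ := h
  simp only [nilpotentScalarRows, nilpotentVectorRows, quadraticRows, List.forall_mem_cons, Poly.total, Term.const,
    List.map_cons, List.map_nil, List.sum_cons, List.sum_nil, List.prod_cons, List.prod_nil,
    Int.cast_neg, Int.cast_one, Int.cast_ofNat, mul_one, one_mul, add_zero] at hs hv hq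
  obtain ⟨e1, e2, e3, e4, e5, e6, e7, e8, -⟩ := hv
  obtain ⟨s1, -⟩ := hs
  obtain ⟨q1, q2, -⟩ := hq
  simp only [h1, h9, ne_eq, not_true, or_false, false_or] at h₃ s1 q1 q2 e1 e3 e6 e7 e8
  have hb : ρ 600 = ρ 107 := mul_right_cancel₀ h₃ (by linear_combination q1)
  rw [hb] at q2
  have hb1 : ρ 107 = 0 := mul_right_cancel₀ h₃ (by linear_combination -q2 / 4)
  rw [hb1] at hb
  simp only [hb1, hb, ne_eq, not_true, or_false, false_or] at hl e1 e3 e6 e7 e8 s1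
  have x1 : ρ 217 = 0 := mul_right_cancel₀ h₃ (by linear_combination -e1 / 2)
  have x2 : ρ 211 = 0 := mul_right_cancel₀ h₃ (by linear_combination -e3)
  have x3 : ρ 10 = 0 := mul_left_cancel₀ hl (by linear_combination e2 / 3 + ρ 3 / 3 * x1)
  have x4 : ρ 11 = 0 := mul_left_cancel₀ hl (by linear_combination e4 / 2 + ρ 3 / 2 * x2)
  simp only [x3, x4, ne_eq, not_true, false_or] at hu
  -- All terms with the unknowns `ρ 101`, `ρ 204`, `ρ 205`, `ρ 301` cancel, which leaves `ρ 102 * ρ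
  -- 12`.
  exact mul_ne_zero hl hu (by linear_combination -s1 / 12 - e6 / 12 - e7 / 12 - e8 / 12 - 2 / 3 * e5)

end

/-! ### Systems without `U_xx` in the equation for `U` -/

/-- Coefficients of the vector part of the commutator that determine the leading coefficients in the
case in which `U_t` does not contain `U_xx`. -/
def nondiffusiveLeadingRows : List ((List Atom × ℕ) × Poly) :=
  [(([.u 0, .u 1, .u 1], 2), [⟨6, [403, 9], []⟩, ⟨4, [305, 9], []⟩, ⟨-36, [600, 10], []⟩]),
    (([.u 0, .u 2, .u 2], 0), [⟨-2, [217, 1], []⟩, ⟨2, [217, 9], []⟩, ⟨2, [213, 9], []⟩,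
      ⟨-18, [600, 10], []⟩]),
    (([.u 0, .u 0, .u 4], 0), [⟨3, [107, 10], []⟩, ⟨-1, [217, 1], []⟩, ⟨1, [217, 9], []⟩,
      ⟨-3, [600, 10], []⟩]),
    (([.dot 0 0, .u 1, .u 1], 2), [⟨2, [402, 9], []⟩, ⟨2, [303, 9], []⟩, ⟨-12, [600, 11], []⟩]),
    (([.dot 0 0, .u 2, .u 2], 0), [⟨-1, [211, 1], []⟩, ⟨1, [211, 9], []⟩, ⟨2, [206, 9], []⟩,
      ⟨-6, [600, 11], []⟩]),
    (([.dot 0 0, .u 0, .u 4], 0), [⟨2, [107, 11], []⟩, ⟨-1, [211, 1], []⟩, ⟨1, [211, 9], []⟩,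
      ⟨-2, [600, 11], []⟩]),
    (([.dot 0 0, .dot 0 0, .u 1], 3), [⟨2, [401, 9], []⟩, ⟨-4, [600, 12], []⟩])]

theorem checkVector_nondiffusiveLeadingRows : checkVector 4 nondiffusiveLeadingRows = true := by
  decide +kernel

/-- Coefficients of the vector part of the commutator that decide the case in which `U_t` does not
contain `U_xx`. -/
def nondiffusiveVectorRows : List ((List Atom × ℕ) × Poly) :=
  [(([.u 1, .u 1, .u 2], 0), [⟨2, [217, 9], []⟩, ⟨-1, [213, 1], []⟩, ⟨5, [213, 9], []⟩,
      ⟨-36, [600, 10], []⟩]),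
    (([.u 0, .u 2, .u 2], 0), [⟨-2, [217, 1], []⟩, ⟨2, [217, 9], []⟩, ⟨2, [213, 9], []⟩,
      ⟨-18, [600, 10], []⟩]),
    (([.dot 0 0, .u 2, .u 2], 0), [⟨-1, [211, 1], []⟩, ⟨1, [211, 9], []⟩, ⟨2, [206, 9], []⟩,
      ⟨-6, [600, 11], []⟩]),
    (([.dot 0 0, .u 1, .u 3], 0), [⟨2, [211, 9], []⟩, ⟨-2, [206, 1], []⟩, ⟨2, [206, 9], []⟩,
      ⟨-8, [600, 11], []⟩]),
    (([.dot 0 1, .u 0, .u 3], 0), [⟨4, [211, 9], []⟩, ⟨-1, [212, 1], []⟩, ⟨1, [212, 9], []⟩,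
      ⟨-16, [600, 11], []⟩]),
    (([.dot 0 2, .u 0, .u 2], 0), [⟨2, [212, 9], []⟩, ⟨-2, [215, 1], []⟩, ⟨2, [215, 9], []⟩,
      ⟨-2, [217, 3], []⟩, ⟨-24, [600, 11], []⟩]),
    (([.dot 0 0, .u 0, .u 3], 1), [⟨-1, [303, 1], []⟩, ⟨1, [303, 9], []⟩, ⟨2, [211, 9], []⟩,
      ⟨-8, [600, 11], []⟩]),
    (([.dot 0 0, .u 0, .u 2], 2), [⟨-2, [402, 1], []⟩, ⟨2, [402, 9], []⟩, ⟨2, [303, 9], []⟩,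
      ⟨-12, [600, 11], []⟩]),
    (([.dot 0 0, .dot 0 2, .u 2], 0), [⟨2, [205, 9], []⟩, ⟨-1, [209, 1], []⟩, ⟨1, [209, 9], []⟩,
      ⟨-1, [211, 3], []⟩, ⟨-24, [600, 12], []⟩]),
    (([.dot 0 0, .dot 0 0, .u 2], 2), [⟨-1, [401, 1], []⟩, ⟨1, [401, 9], []⟩, ⟨2, [301, 9], []⟩,
      ⟨-6, [600, 12], []⟩]),
    (([.u 0, .u 0, .u 2], 2), [⟨-3, [403, 1], []⟩, ⟨3, [403, 9], []⟩, ⟨2, [305, 9], []⟩,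
      ⟨-18, [600, 10], []⟩]),
    (([.dot 0 0, .dot 1 0, .u 2], 0), [⟨4, [204, 9], []⟩, ⟨2, [205, 9], []⟩, ⟨-1, [208, 1], []⟩,
      ⟨1, [208, 9], []⟩, ⟨-1, [211, 4], []⟩, ⟨-24, [600, 12], []⟩]),
    (([.dot 1 0, .u 0, .u 2], 0), [⟨2, [211, 9], []⟩, ⟨2, [212, 9], []⟩, ⟨-2, [214, 1], []⟩,
      ⟨2, [214, 9], []⟩, ⟨-2, [217, 4], []⟩, ⟨-24, [600, 11], []⟩]),
    (([.dot 0 0, .dot 0 0, .dot 0 0, .dot 0 0, .dot 0 0, .u 0], 2), [⟨-6, [400, 12], []⟩,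
      ⟨-4, [401, 13], []⟩, ⟨-1, [401, 7], []⟩, ⟨-2, [402, 8], []⟩]),
    (([.dot 0 0, .dot 0 0, .u 0, .u 0, .u 0, .u 2], 0), [⟨3, [115, 10], []⟩, ⟨2, [122, 11], []⟩,
      ⟨1, [128, 12], []⟩, ⟨-4, [219, 1], []⟩, ⟨4, [219, 9], []⟩, ⟨-3, [401, 10], []⟩,
      ⟨-4, [204, 10], []⟩, ⟨-4, [204, 2], []⟩, ⟨-3, [209, 10], []⟩, ⟨-2, [402, 11], []⟩,
      ⟨-4, [211, 5], []⟩, ⟨-2, [215, 11], []⟩, ⟨-1, [403, 12], []⟩, ⟨4, [217, 12], []⟩,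
      ⟨-4, [217, 6], []⟩]),
    (([.dot 0 0, .dot 0 0, .dot 0 0, .dot 0 0, .u 0, .u 2], 0), [⟨2, [108, 11], []⟩,
      ⟨1, [115, 12], []⟩, ⟨-2, [216, 1], []⟩, ⟨2, [216, 9], []⟩, ⟨-2, [400, 11], []⟩,
      ⟨-2, [202, 11], []⟩, ⟨-1, [401, 12], []⟩, ⟨-2, [204, 6], []⟩, ⟨-1, [209, 12], []⟩,
      ⟨4, [211, 13], []⟩, ⟨-2, [211, 7], []⟩, ⟨-2, [217, 8], []⟩]),
    (([.dot 0 0, .dot 0 0, .dot 0 0, .u 0, .u 0, .u 2], 0), [⟨3, [108, 10], []⟩, ⟨2, [115, 11], []⟩,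
      ⟨1, [122, 12], []⟩, ⟨-3, [218, 1], []⟩, ⟨3, [218, 9], []⟩, ⟨-3, [400, 10], []⟩,
      ⟨-3, [202, 10], []⟩, ⟨-2, [401, 11], []⟩, ⟨-2, [204, 11], []⟩, ⟨-3, [204, 5], []⟩,
      ⟨-2, [209, 11], []⟩, ⟨-1, [402, 12], []⟩, ⟨2, [211, 12], []⟩, ⟨-3, [211, 6], []⟩,
      ⟨-1, [215, 12], []⟩, ⟨6, [217, 13], []⟩, ⟨-3, [217, 7], []⟩]),
    (([.dot 0 0, .dot 0 0, .dot 0 0, .dot 0 0, .dot 0 0, .dot 0 0, .dot 0 0, .u 0, .u 0], 0),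
      [⟨3, [106, 10], []⟩, ⟨2, [114, 11], []⟩, ⟨1, [121, 12], []⟩, ⟨-10, [203, 11], []⟩,
      ⟨-6, [210, 12], []⟩, ⟨-1, [210, 6], []⟩, ⟨-2, [216, 13], []⟩, ⟨-2, [216, 7], []⟩,
      ⟨-3, [218, 8], []⟩]),
    (([.dot 0 0, .dot 0 0, .dot 0 0, .dot 0 0, .dot 0 2, .u 0], 0), [⟨2, [105, 11], []⟩,
      ⟨1, [113, 12], []⟩, ⟨-2, [216, 3], []⟩, ⟨-6, [202, 12], []⟩, ⟨-6, [204, 7], []⟩,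
      ⟨-4, [209, 13], []⟩, ⟨-1, [209, 7], []⟩, ⟨-8, [211, 8], []⟩, ⟨-2, [215, 8], []⟩]),
    (([.dot 0 0, .dot 0 0, .dot 0 0, .dot 0 0, .dot 0 0, .u 2], 0), [⟨1, [108, 12], []⟩,
      ⟨-1, [210, 1], []⟩, ⟨1, [210, 9], []⟩, ⟨-1, [400, 12], []⟩, ⟨-1, [202, 12], []⟩,
      ⟨2, [204, 13], []⟩, ⟨-1, [204, 7], []⟩, ⟨-1, [211, 8], []⟩]),
    (([.dot 0 0, .dot 0 0, .dot 0 0, .dot 0 0, .dot 0 0, .dot 0 2], 0), [⟨1, [105, 12], []⟩,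
      ⟨-1, [210, 3], []⟩, ⟨-6, [202, 13], []⟩, ⟨-8, [204, 8], []⟩, ⟨-1, [209, 8], []⟩]),
    (([.dot 0 0, .dot 0 0, .u 4], 0), [⟨1, [107, 12], []⟩, ⟨-1, [204, 1], []⟩, ⟨1, [204, 9], []⟩,
      ⟨-1, [600, 12], []⟩])]

theorem checkVector_nondiffusiveVectorRows : checkVector 4 nondiffusiveVectorRows = true := by
  decide +kernel

/-- Coefficients of the scalar part of the commutator that decide the case in which `U_t` does not
contain `U_xx`. -/
def nondiffusiveScalarRows : List (List Atom × Poly) :=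
  [([.u 0, .u 0, .u 2, .u 2], [⟨2, [124, 1], []⟩, ⟨-36, [107, 2], []⟩]),
    ([.u 1, .u 1, .u 1, .u 1], [⟨2, [124, 1], []⟩, ⟨-24, [107, 2], []⟩]),
    ([.dot 0 0, .u 0, .u 2, .u 2], [⟨2, [117, 1], []⟩, ⟨-18, [102, 10], []⟩, ⟨-18, [107, 5], []⟩,
      ⟨2, [217, 3], []⟩, ⟨2, [213, 3], []⟩]),
    ([.dot 0 0, .u 0, .u 1, .u 3], [⟨4, [122, 1], []⟩, ⟨-24, [102, 10], []⟩, ⟨-24, [107, 5], []⟩,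
      ⟨4, [217, 3], []⟩, ⟨2, [213, 3], []⟩]),
    ([.dot 0 0, .u 1, .u 1, .u 2], [⟨2, [122, 1], []⟩, ⟨4, [117, 1], []⟩, ⟨-36, [102, 10], []⟩,
      ⟨-36, [107, 5], []⟩, ⟨2, [217, 3], []⟩, ⟨5, [213, 3], []⟩]),
    ([.dot 0 0, .dot 0 0, .u 1, .u 3], [⟨2, [115, 1], []⟩, ⟨-8, [102, 11], []⟩, ⟨-8, [107, 6], []⟩,
      ⟨2, [211, 3], []⟩, ⟨2, [206, 3], []⟩]),
    ([.dot 0 0, .dot 0 0, .u 2, .u 2], [⟨2, [110, 1], []⟩, ⟨-6, [102, 11], []⟩, ⟨-6, [107, 6], []⟩,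
      ⟨1, [211, 3], []⟩, ⟨2, [206, 3], []⟩]),
    ([.dot 0 0, .dot 0 2, .u 0, .u 2], [⟨4, [115, 1], []⟩, ⟨-4, [115, 9], []⟩, ⟨2, [116, 1], []⟩,
      ⟨-2, [122, 3], []⟩, ⟨-36, [102, 11], []⟩, ⟨-4, [100, 11], []⟩, ⟨-48, [107, 6], []⟩,
      ⟨2, [402, 3], []⟩, ⟨2, [303, 3], []⟩, ⟨4, [211, 3], []⟩, ⟨2, [212, 3], []⟩,
      ⟨2, [215, 3], []⟩]),
    ([.dot 0 0, .dot 0 1, .u 1, .u 2], [⟨8, [115, 1], []⟩, ⟨16, [110, 1], []⟩, ⟨2, [116, 1], []⟩,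
      ⟨-72, [102, 11], []⟩, ⟨-6, [101, 11], []⟩, ⟨-96, [107, 6], []⟩, ⟨3, [303, 3], []⟩,
      ⟨6, [211, 3], []⟩, ⟨2, [211, 4], []⟩, ⟨12, [206, 3], []⟩, ⟨4, [206, 4], []⟩,
      ⟨3, [212, 3], []⟩]),
    ([.u 0, .u 0, .u 1, .u 3], [⟨6, [128, 1], []⟩, ⟨-48, [107, 2], []⟩]),
    ([.dot 0 4, .u 0, .u 0, .u 0], [⟨1, [126, 1], []⟩, ⟨-1, [126, 9], []⟩, ⟨-2, [102, 10], []⟩,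
      ⟨4, [102, 2], []⟩, ⟨-1, [128, 3], []⟩, ⟨-2, [107, 5], []⟩, ⟨1, [403, 3], []⟩,
      ⟨2, [600, 5], []⟩]),
    ([.dot 2 0, .u 0, .u 0, .u 0], [⟨1, [126, 1], []⟩, ⟨-1, [126, 9], []⟩, ⟨2, [125, 1], []⟩,
      ⟨-2, [100, 10], []⟩, ⟨4, [100, 2], []⟩, ⟨-1, [128, 3], []⟩, ⟨-2, [128, 4], []⟩,
      ⟨-6, [107, 5], []⟩, ⟨1, [403, 3], []⟩]),
    ([.dot 0 0, .dot 0 4, .u 0, .u 0], [⟨1, [120, 1], []⟩, ⟨-1, [120, 9], []⟩, ⟨-1, [122, 3], []⟩,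
      ⟨-4, [102, 11], []⟩, ⟨3, [102, 5], []⟩, ⟨-4, [107, 6], []⟩, ⟨1, [402, 3], []⟩,
      ⟨1, [215, 3], []⟩, ⟨4, [600, 6], []⟩]),
    ([.dot 0 0, .dot 2 0, .u 0, .u 0], [⟨1, [120, 1], []⟩, ⟨-1, [120, 9], []⟩, ⟨2, [119, 1], []⟩,
      ⟨-1, [122, 3], []⟩, ⟨-2, [122, 4], []⟩, ⟨-6, [102, 11], []⟩, ⟨-2, [100, 11], []⟩,
      ⟨3, [100, 5], []⟩, ⟨-12, [107, 6], []⟩, ⟨1, [402, 3], []⟩, ⟨1, [215, 3], []⟩,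
      ⟨2, [214, 3], []⟩]),
    ([.dot 0 0, .dot 0 1, .dot 0 1, .u 0, .u 0, .u 0, .u 0], [⟨24, [129, 1], []⟩,
      ⟨-6, [111, 10], []⟩, ⟨3, [111, 2], []⟩, ⟨-2, [116, 5], []⟩, ⟨-4, [120, 11], []⟩,
      ⟨-4, [119, 11], []⟩, ⟨-8, [122, 6], []⟩, ⟨-8, [118, 11], []⟩, ⟨1, [118, 5], []⟩,
      ⟨-4, [123, 6], []⟩, ⟨-16, [126, 12], []⟩, ⟨-8, [125, 12], []⟩, ⟨-24, [128, 7], []⟩,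
      ⟨16, [219, 3], []⟩, ⟨8, [219, 4], []⟩, ⟨2, [302, 5], []⟩, ⟨2, [207, 5], []⟩,
      ⟨4, [304, 6], []⟩]),
    ([.dot 0 0, .dot 0 0, .dot 0 0, .dot 0 0, .u 0, .u 1, .u 1], [⟨6, [127, 1], []⟩,
      ⟨-6, [105, 10], []⟩, ⟨-6, [108, 5], []⟩, ⟨-2, [109, 11], []⟩, ⟨-2, [113, 11], []⟩,
      ⟨-2, [115, 6], []⟩, ⟨-4, [110, 12], []⟩, ⟨-2, [110, 6], []⟩, ⟨-1, [116, 12], []⟩,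
      ⟨-2, [117, 13], []⟩, ⟨-2, [117, 7], []⟩, ⟨-2, [124, 8], []⟩, ⟨6, [218, 3], []⟩,
      ⟨6, [206, 7], []⟩, ⟨8, [213, 8], []⟩]),
    ([.dot 0 0, .dot 0 0, .dot 0 0, .dot 0 0, .dot 0 0, .dot 0 0, .dot 0 0, .u 0, .u 0, .u 0],
      [⟨-14, [106, 10], []⟩, ⟨4, [106, 2], []⟩, ⟨-12, [114, 11], []⟩, ⟨2, [114, 5], []⟩,
      ⟨-10, [121, 12], []⟩, ⟨-8, [127, 13], []⟩, ⟨-2, [127, 7], []⟩, ⟨-4, [129, 8], []⟩,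
      ⟨2, [203, 5], []⟩, ⟨4, [210, 6], []⟩, ⟨6, [216, 7], []⟩, ⟨8, [218, 8], []⟩]),
    ([.dot 0 0, .dot 0 0, .dot 0 0, .dot 0 0, .dot 0 0, .dot 0 0, .dot 0 0, .dot 0 0, .u 0, .u 0],
      [⟨-14, [106, 11], []⟩, ⟨3, [106, 5], []⟩, ⟨-12, [114, 12], []⟩, ⟨1, [114, 6], []⟩,
      ⟨-10, [121, 13], []⟩, ⟨-1, [121, 7], []⟩, ⟨-3, [127, 8], []⟩, ⟨4, [203, 6], []⟩,
      ⟨6, [210, 7], []⟩, ⟨8, [216, 8], []⟩]),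
    ([.dot 0 0, .dot 0 0, .dot 0 0, .dot 0 0, .dot 0 2, .u 0, .u 0], [⟨10, [121, 1], []⟩,
      ⟨-10, [121, 9], []⟩, ⟨-3, [127, 3], []⟩, ⟨-10, [105, 11], []⟩, ⟨3, [105, 5], []⟩,
      ⟨-4, [108, 6], []⟩, ⟨-10, [113, 12], []⟩, ⟨1, [113, 6], []⟩, ⟨-6, [115, 7], []⟩,
      ⟨-10, [120, 13], []⟩, ⟨-1, [120, 7], []⟩, ⟨-8, [122, 8], []⟩, ⟨-3, [126, 8], []⟩,
      ⟨10, [216, 3], []⟩, ⟨4, [400, 6], []⟩, ⟨4, [202, 6], []⟩, ⟨6, [401, 7], []⟩,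
      ⟨6, [209, 7], []⟩, ⟨8, [402, 8], []⟩, ⟨8, [215, 8], []⟩]),
    ([.dot 0 0, .dot 0 0, .dot 0 0, .dot 0 0, .dot 1 0, .u 0, .u 0], [⟨10, [121, 1], []⟩,
      ⟨-3, [127, 4], []⟩, ⟨-2, [105, 11], []⟩, ⟨-8, [104, 11], []⟩, ⟨3, [104, 5], []⟩,
      ⟨-4, [108, 6], []⟩, ⟨-4, [113, 12], []⟩, ⟨-6, [112, 12], []⟩, ⟨1, [112, 6], []⟩,
      ⟨-6, [115, 7], []⟩, ⟨-6, [120, 13], []⟩, ⟨-4, [119, 13], []⟩, ⟨-1, [119, 7], []⟩,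
      ⟨-8, [122, 8], []⟩, ⟨-3, [125, 8], []⟩, ⟨8, [216, 3], []⟩, ⟨2, [216, 4], []⟩,
      ⟨4, [201, 6], []⟩, ⟨6, [208, 7], []⟩, ⟨8, [214, 8], []⟩]),
    ([.dot 0 0, .dot 0 0, .dot 0 4, .u 0], [⟨1, [113, 1], []⟩, ⟨-1, [113, 9], []⟩,
      ⟨-1, [115, 3], []⟩, ⟨-6, [102, 12], []⟩, ⟨2, [102, 6], []⟩, ⟨-6, [107, 7], []⟩,
      ⟨1, [401, 3], []⟩, ⟨1, [209, 3], []⟩, ⟨6, [600, 7], []⟩]),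
    ([.dot 0 0, .dot 0 0, .dot 1 2, .u 0], [⟨2, [113, 1], []⟩, ⟨2, [112, 1], []⟩,
      ⟨-2, [112, 9], []⟩, ⟨-2, [115, 3], []⟩, ⟨-2, [115, 4], []⟩, ⟨-16, [102, 12], []⟩,
      ⟨-2, [101, 12], []⟩, ⟨2, [101, 6], []⟩, ⟨-24, [107, 7], []⟩, ⟨2, [401, 4], []⟩,
      ⟨2, [209, 3], []⟩, ⟨2, [208, 3], []⟩]),
    ([.dot 0 0, .dot 0 0, .dot 0 0, .dot 0 0, .dot 0 0, .u 0, .u 2], [⟨-2, [105, 11], []⟩,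
      ⟨-6, [108, 12], []⟩, ⟨-1, [113, 12], []⟩, ⟨-4, [115, 13], []⟩, ⟨-1, [115, 7], []⟩,
      ⟨-2, [122, 8], []⟩, ⟨2, [216, 3], []⟩, ⟨6, [204, 7], []⟩, ⟨8, [211, 8], []⟩]),
    ([.dot 0 0, .dot 0 0, .dot 0 0, .dot 0 0, .dot 0 0, .dot 0 2, .u 0], [⟨12, [114, 1], []⟩,
      ⟨-12, [114, 9], []⟩, ⟨-2, [121, 3], []⟩, ⟨-12, [105, 12], []⟩, ⟨2, [105, 6], []⟩,
      ⟨-6, [108, 7], []⟩, ⟨-12, [113, 13], []⟩, ⟨-8, [115, 8], []⟩, ⟨-2, [120, 8], []⟩,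
      ⟨12, [210, 3], []⟩, ⟨6, [400, 7], []⟩, ⟨6, [202, 7], []⟩, ⟨8, [401, 8], []⟩,
      ⟨8, [209, 8], []⟩])]

theorem checkScalar_nondiffusiveScalarRows : checkScalar 4 nondiffusiveScalarRows = true := by
  decide +kernel

section

variable {ρ : ℕ → ℂ}

/-- With `a₉ = 0` three rows reduce to multiples of `ρ 600` times `a₁₀`, `a₁₁`, `a₁₂`, one of which
is non-zero; hence `ρ 600 = 0`. A non-zero `a₁₀` or `a₁₁` would also force `ρ 107 = 0`, leaving no
leading coefficient. -/
theorem nondiffusive_leading (hq : ∀ e ∈ quadraticRows, e.2.total ρ = 0)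
    (hv : ∀ e ∈ nondiffusiveLeadingRows, e.2.total ρ = 0) (h₁ : ρ 1 ≠ 0) (z9 : ρ 9 = 0)
    (hu : ρ 10 ≠ 0 ∨ ρ 11 ≠ 0 ∨ ρ 12 ≠ 0) (hl : ρ 107 ≠ 0 ∨ ρ 102 ≠ 0 ∨ ρ 600 ≠ 0) :
    ρ 107 ≠ 0 ∧ ρ 600 = 0 ∧ ρ 10 = 0 ∧ ρ 11 = 0 ∧ ρ 12 ≠ 0 := by
  have hlin := leading_eq_zero_of_quadraticRows hq (.inl h₁)
  have hb : ¬ (ρ 600 = 0 ∧ ρ 107 = 0) := fun ⟨h, h'⟩ => by simp [h, h', hlin h' h] at hl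
  simp only [nondiffusiveLeadingRows, List.forall_mem_cons, Poly.total, Term.const,
    List.map_cons, List.map_nil, List.sum_cons, List.sum_nil, List.prod_cons, List.prod_nil,
    Int.cast_neg, Int.cast_one, Int.cast_ofNat, mul_one, one_mul, add_zero] at hv
  obtain ⟨e1, e2, e3, e4, e5, e6, e7, -⟩ := hv
  simp only [z9, mul_zero, zero_add] at e1 e2 e3 e4 e5 e6 e7
  have z10 : ρ 10 = 0 := by
    by_contra h
    have h9 : ρ 600 = 0 := mul_right_cancel₀ h (by linear_combination -e1 / 36)
    have hq : ρ 217 = 0 := by simpa [h9, h₁] using e2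
    exact hb ⟨h9, by simpa [h9, hq, h] using e3⟩
  have z11 : ρ 11 = 0 := by
    by_contra h
    have h9 : ρ 600 = 0 := mul_right_cancel₀ h (by linear_combination -e4 / 12)
    have hq : ρ 211 = 0 := by simpa [h9, h₁] using e5
    exact hb ⟨h9, by simpa [h9, hq, h] using e6⟩
  have h12 : ρ 12 ≠ 0 := by simpa [z10, z11] using hu
  have h9 : ρ 600 = 0 := mul_right_cancel₀ h12 (by linear_combination -e7 / 4)
  exact ⟨fun h => hb ⟨h9, h⟩, h9, z10, z11, h12⟩

/-- The elimination is triangular. Rows with common unknowns but different multiples of `ρ 107 * aᵢ`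
give `a₂ = a₅ = a₆ = 0`, after which most unknowns of the symmetry vanish one after another. The few
that survive tie the other `aᵢ` to the combination `w = u + l⟨U, U⟩`. -/
theorem nondiffusive_coeffs (hq : ∀ e ∈ quadraticRows, e.2.total ρ = 0)
    (hv : ∀ e ∈ nondiffusiveVectorRows, e.2.total ρ = 0)
    (hs : ∀ e ∈ nondiffusiveScalarRows, e.2.total ρ = 0) (h₁ : ρ 1 ≠ 0) (z9 : ρ 9 = 0)
    (hb : ρ 107 ≠ 0) (z600 : ρ 600 = 0) (z10 : ρ 10 = 0) (z11 : ρ 11 = 0) (h₁₂ : ρ 12 ≠ 0) :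
    ∃ l, ρ 2 = 0 ∧ ρ 3 = 2 * l * ρ 1 ∧ ρ 4 = 2 * l * ρ 1 ∧ ρ 5 = 0 ∧ ρ 6 = 0 ∧
      ρ 7 = -2 * l * ρ 12 ∧ ρ 8 = -2 * l ^ 2 * ρ 12 ∧ ρ 13 = l * ρ 12 := by
  simp only [quadraticRows, nondiffusiveVectorRows, nondiffusiveScalarRows, List.forall_mem_cons, Poly.total, Term.const,
    List.map_cons, List.map_nil, List.sum_cons, List.sum_nil, List.prod_cons, List.prod_nil,
    Int.cast_neg, Int.cast_one, Int.cast_ofNat, mul_one, one_mul, add_zero] at hv hs hq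
  obtain ⟨e1, e2, e3, e4, e5, e6, e7, e8, e9, e10, e11, e12, e13, e14, e15, e16, e17, e18, e19,
    e20, e21, e22, -⟩ := hv
  obtain ⟨s1, s2, s3, s4, s5, s6, s7, s8, s9, s10, s11, s12, s13, s14, s15, s16, s17, s18, s19,
    s20, s21, s22, s23, s24, -⟩ := hs
  obtain ⟨q1, q2, -⟩ := hq
  have z213 : ρ 213 = 0 := by simpa [z9, z600, h₁] using e1
  have z217 : ρ 217 = 0 := by simpa [z9, z213, z600, h₁] using e2
  have z211 : ρ 211 = 0 := by simpa [z9, z600, h₁] using e3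
  have z206 : ρ 206 = 0 := by simpa [z211, z9, z600, h₁] using e4
  have z212 : ρ 212 = 0 := by simpa [z211, z9, z600, h₁] using e5
  have z215 : ρ 215 = 0 := by simpa [z212, z9, z217, z600, h₁] using e6
  have z303 : ρ 303 = 0 := by simpa [z9, z211, z600, h₁] using e7
  have z402 : ρ 402 = 0 := by simpa [z9, z303, z600, h₁] using e8
  -- The unknown `ρ 124` enters both rows alike, but the multiples of `ρ 107 * ρ 2` differ.
  have z2 : ρ 2 = 0 := mul_left_cancel₀ hb (by linear_combination (s1 - s2) / (-12))
  simp only [z10, z217, z213, mul_zero, zero_mul, add_zero, zero_add] at s3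
  simp only [z10, z217, z213, mul_zero, zero_mul, add_zero, zero_add] at s4
  simp only [z10, z217, z213, mul_zero, zero_mul, add_zero, zero_add] at s5
  -- The combination cancels `ρ 117` and `ρ 122`.
  have z5 : ρ 5 = 0 := mul_left_cancel₀ hb (by linear_combination (2 * s3 + s4 / 2 - s5) / (-12))
  have z122 : ρ 122 = 0 := by simpa [z5, h₁] using s4
  simp only [z11, z211, z206, mul_zero, zero_mul, add_zero, zero_add] at s6
  simp only [z11, z211, z206, mul_zero, zero_mul, add_zero, zero_add] at s7
  simp only [z9, z122, z11, z402, z303, z211, z212, z215, mul_zero, zero_mul, add_zero, zero_add]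
    at s8
  simp only [z11, z303, z211, z206, z212, mul_zero, zero_mul, add_zero, zero_add] at s9
  -- The combination cancels `ρ 110`, `ρ 115` and `ρ 116`.
  have z6 : ρ 6 = 0 := mul_left_cancel₀ hb (by linear_combination (s8 + 2 * s6 + 8 * s7 - s9) /
    (-16))
  have z209 : ρ 209 = 0 := by simpa [z9, z211, z600, h₁] using e9
  have z401 : ρ 401 = 0 := by simpa [z9, z600, h₁] using e10
  have z117 : ρ 117 = 0 := by simpa [z5, h₁] using s3
  have z110 : ρ 110 = 0 := by simpa [z6, h₁] using s7
  have z124 : ρ 124 = 0 := by simpa [z2, h₁] using s2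
  have z128 : ρ 128 = 0 := by simpa [z2, h₁] using s10
  have z403 : ρ 403 = 0 := by simpa [z9, z600, h₁] using e11
  have z126 : ρ 126 = 0 := by simpa [z9, z10, z2, z128, z5, z403, z600, h₁] using s11
  have z208 : ρ 208 = 0 := by simpa [z9, z211, z600, h₁] using e12
  have z214 : ρ 214 = 0 := by simpa [z211, z212, z9, z217, z600, h₁] using e13
  have z400 : ρ 400 = 0 := by simpa [z401, z402, h₁₂] using e14
  have z115 : ρ 115 = 0 := by simpa [z6, h₁] using s6
  have z116 : ρ 116 = 0 := by simpa [z115, z110, z6, h₁] using s9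
  have z219 : ρ 219 = 0 := by simpa [z115, z122, z128, z9, z401, z10, z2, z209, z402, z211, z215,
    z403, z217, z6, h₁] using e15
  have z125 : ρ 125 = 0 := by simpa [z126, z9, z10, z2, z128, z5, z403, h₁] using s12
  have z120 : ρ 120 = 0 := by simpa [z9, z122, z11, z5, z6, z402, z215, z600, h₁] using s13
  have z119 : ρ 119 = 0 := by simpa [z120, z9, z122, z11, z5, z6, z402, z215, z214, h₁] using s14
  have z216 : ρ 216 = 0 := by simpa [z11, z115, z9, z400, z401, z6, z209, z211, z217, h₁] using e16
  have z218 : ρ 218 = 0 := by simpa [z10, z115, z122, z9, z400, z401, z11, z5, z209, z402, z211,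
    z6, z215, z217, h₁] using e17
  have z129 : ρ 129 = 0 := by simpa [z10, z2, z116, z120, z119, z122, z11, z5, z6, z126, z125,
    z128, z219, h₁] using s15
  have z127 : ρ 127 = 0 := by simpa [z10, z5, z11, z115, z110, z6, z116, z117, z124, z218, z206,
    z213, h₁] using s16
  have z121 : ρ 121 = 0 := by simpa [z10, z2, z11, z5, z127, z129, z6, z216, z218, h₁₂] using s17
  have z210 : ρ 210 = 0 := by simpa [z10, z11, z121, z6, z216, z218, h₁₂] using e18
  have z114 : ρ 114 = 0 := by simpa [z11, z5, z6, z121, z127, z210, z216, h₁₂] using s18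
  have z113 : ρ 113 = 0 := by simpa [z121, z9, z127, z11, z5, z6, z115, z120, z122, z126, z216,
    z400, z401, z209, z402, z215, h₁₂] using s19
  have z112 : ρ 112 = 0 := by simpa [z121, z127, z11, z5, z6, z113, z115, z120, z119, z122, z125,
    z216, z208, z214, h₁₂] using s20
  simp only [z113, z9, z115, z6, z401, z209, z600, mul_zero, zero_mul, add_zero, zero_add] at s21
  simp only [z113, z112, z9, z115, z6, z401, z209, z208, mul_zero, zero_mul, add_zero, zero_add]
    at s22
  simp only [z9, z600, mul_zero, zero_mul, add_zero, zero_add] at q2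
  simp only [z9, z600, mul_zero, zero_mul, add_zero, zero_add] at q1
  simp only [z11, z113, z216, z209, z211, z215, mul_zero, zero_mul, add_zero, zero_add] at e19
  simp only [z210, z9, z400, z211, mul_zero, zero_mul, add_zero, zero_add] at e20
  simp only [z11, z113, z115, z122, z216, z211, mul_zero, zero_mul, add_zero, zero_add] at s23
  simp only [z114, z9, z121, z6, z113, z115, z120, z210, z400, z401, z209, mul_zero, zero_mul,
    add_zero, zero_add] at s24
  simp only [z210, z209, mul_zero, zero_mul, add_zero, zero_add] at e21
  simp only [z9, z600, mul_zero, zero_mul, add_zero] at e22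
  -- With this `l` the second-order part of `u_t` becomes `a₁w_xx` for `w = u + l⟨U, U⟩`, once `a₄ =
  -- a₃` is known. The values of `ρ 102` and `ρ 101` found next are the corresponding coefficients
  -- of `ρ 107 * ∂ₓ⁴w`.
  obtain ⟨l, h3⟩ : ∃ l, ρ 3 = 2 * l * ρ 1 := ⟨ρ 3 / (2 * ρ 1), by field_simp⟩
  have hc : ρ 102 = 2 * l * ρ 107 :=
    mul_left_cancel₀ h₁ (by linear_combination q1 + ρ 107 * h3)
  have h7 : ρ 7 = -2 * l * ρ 12 :=
    mul_left_cancel₀ hb (by linear_combination -s21 / 6 - ρ 12 * hc)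
  have hc2 : ρ 101 = 8 * l * ρ 107 := mul_left_cancel₀ h₁₂ (by
    linear_combination -s22 / 2 - 8 * ρ 12 * hc - 12 * ρ 107 * h7)
  have h4 : ρ 4 = ρ 3 := mul_left_cancel₀ hb (by
    linear_combination -q2 / 2 + ρ 1 * hc + ρ 1 / 2 * hc2 - 3 * ρ 107 * h3)
  -- `ρ 204` multiplies `⟨U, U⟩²u_xx U` in the symmetry. All remaining unknowns turn out to be
  -- multiples of it, so that it can be cancelled.
  have hQ : ρ 204 ≠ 0 := by
    intro h
    rw [h] at e22
    exact mul_ne_zero hb h₁₂ (by linear_combination e22)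
  have hk : ρ 202 = 2 * l * ρ 204 := mul_left_cancel₀ h₁₂ (by
    linear_combination -e19 / 6 - ρ 204 * h7)
  have hP : ρ 108 = -2 * l * ρ 204 := mul_left_cancel₀ h₁₂ (by
    linear_combination -s23 / 6 + ρ 204 * h7)
  have h13 : ρ 13 = l * ρ 12 := mul_left_cancel₀ hQ (by
    linear_combination e20 / 2 - ρ 12 / 2 * hP + ρ 12 / 2 * hk + ρ 204 / 2 * h7)
  have hP2 : ρ 105 = -4 * l ^ 2 * ρ 204 := mul_left_cancel₀ h₁₂ (by
    linear_combination -s24 / 12 - ρ 7 / 2 * hP + ρ 7 / 2 * hk + 2 * l * ρ 204 * h7)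
  refine ⟨l, z2, h3, by rw [h4, h3], z5, z6, h7, mul_left_cancel₀ hQ ?_, h13⟩
  linear_combination -e21 / 8 + ρ 12 / 8 * hP2 - 6 / 8 * ρ 13 * hk - 3 / 2 * l * ρ 204 * h13

end

/-! ### Systems with a symmetry of order four -/

theorem scale_add (ξ α β : ℂ) (P Q : ScalarExpr) : ScalarExpr.scale ξ α β (P + Q) =
    ScalarExpr.scale ξ α β P + ScalarExpr.scale ξ α β Q := map_add _ _ _

theorem scale_mul (ξ α β : ℂ) (P Q : ScalarExpr) : ScalarExpr.scale ξ α β (P * Q) =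
    ScalarExpr.scale ξ α β P * ScalarExpr.scale ξ α β Q := map_mul _ _ _

theorem scale_pow (ξ α β : ℂ) (P : ScalarExpr) (n : ℕ) : ScalarExpr.scale ξ α β (P ^ n) =
    ScalarExpr.scale ξ α β P ^ n := map_pow _ _ _

theorem scale_C (ξ α β c : ℂ) : ScalarExpr.scale ξ α β (C c) = C c := aeval_C _ _

theorem scale_zero (ξ α β : ℂ) : ScalarExpr.scale ξ α β 0 = 0 := map_zero _

theorem scale_du (ξ α β : ℂ) (m : ℕ) :
    ScalarExpr.scale ξ α β (du m) = C α * C ξ ^ m * du m := by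
  simp [ScalarExpr.scale, du, Factor.scale]

theorem scale_dotU (ξ α β : ℂ) (m n : ℕ) :
    ScalarExpr.scale ξ α β (dotU m n) = C β ^ 2 * C ξ ^ (m + n) * dotU m n := by
  simp only [ScalarExpr.scale, dotU, Factor.scale, aeval_X, Sym2.lift_mk, map_mul, map_pow]
  ring

variable {a : Coeffs}

/-- With `α = l` and `β = 1` the combination `u + l⟨U, U⟩` becomes `l(ũ + ⟨Ũ, Ũ⟩)`. The equation for
`U` fixes `τ = -a₁₂l`, and `ξ` is a square root chosen so that `a₁ξ² = τ`. -/
theorem Coeffs.scalesTo_systemOne {l : ℂ} (hl : l ≠ 0) (h₁ : a.a₁ ≠ 0) (h₁₂ : a.a₁₂ ≠ 0)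
    (h₂ : a.a₂ = 0) (h₃ : a.a₃ = 2 * l * a.a₁) (h₄ : a.a₄ = 2 * l * a.a₁) (h₅ : a.a₅ = 0)
    (h₆ : a.a₆ = 0) (h₇ : a.a₇ = -2 * l * a.a₁₂) (h₈ : a.a₈ = -2 * l ^ 2 * a.a₁₂)
    (h₉ : a.a₉ = 0) (h₁₀ : a.a₁₀ = 0) (h₁₁ : a.a₁₁ = 0) (h₁₃ : a.a₁₃ = l * a.a₁₂) :
    a.system.ScalesTo systemOne := by
  obtain ⟨ξ, hξ⟩ := IsAlgClosed.exists_pow_nat_eq (-(a.a₁₂ * l) / a.a₁) zero_lt_two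
  have hξ' : ξ ^ 2 * a.a₁ = -(a.a₁₂ * l) := by rw [hξ]; field_simp
  have e : (C ξ ^ 2 * C a.a₁ : ScalarExpr) = -(C a.a₁₂ * C l) := by
    rw [← map_pow, ← map_mul, hξ', map_neg, map_mul]
  have hξ0 : ξ ≠ 0 := by
    rintro rfl
    simp [h₁₂, hl] at hξ'
  refine ⟨-(a.a₁₂ * l), ξ, l, 1, by simp [h₁₂, hl], hξ0, hl, one_ne_zero, ?_, fun k => ?_⟩
  · simp only [Coeffs.system, systemOne, scale_add, scale_mul, scale_pow, scale_C, scale_du,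
      scale_dotU]
    simp only [h₂, h₃, h₄, h₅, h₆, h₇, h₈, map_mul, map_neg, map_pow, map_ofNat, map_zero, map_one]
    linear_combination -C l * (du 2 + 2 * dotU 0 2 + 2 * dotU 1 1) * e
  · simp only [Coeffs.system, systemOne, smulU, Finsupp.add_apply, Finsupp.single_apply]
    by_cases h : 0 = k
    · subst h
      simp only [if_true, OfNat.ofNat_ne_zero, if_false, scale_add, scale_mul, scale_pow,
        scale_C, scale_zero, scale_du, scale_dotU]
      simp only [h₁₀, h₁₁, h₁₃, map_mul, map_neg, map_pow, map_zero, map_one]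
      ring
    · simp [h, h₉, scale_zero]

/-- Again `α = l` and `β = 1`. The factor of `U` is `a₁₀(u + l⟨U, U⟩)³`, which fixes `τ = a₁₀l³`,
and `ξ` satisfies `a₉ξ² = τ`. -/
theorem Coeffs.scalesTo_systemTwo {l : ℂ} (hl : l ≠ 0) (h₉ : a.a₉ ≠ 0) (h₁₀ : a.a₁₀ ≠ 0)
    (h₁ : a.a₁ = 0) (h₂ : a.a₂ = 0) (h₃ : a.a₃ = -2 * l * a.a₉) (h₄ : a.a₄ = 0)
    (h₅ : a.a₅ = -2 * l * a.a₁₀) (h₆ : a.a₆ = -6 * l ^ 2 * a.a₁₀)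
    (h₇ : a.a₇ = -6 * l ^ 3 * a.a₁₀) (h₈ : a.a₈ = -2 * l ^ 4 * a.a₁₀)
    (h₁₁ : a.a₁₁ = 3 * l * a.a₁₀) (h₁₂ : a.a₁₂ = 3 * l ^ 2 * a.a₁₀)
    (h₁₃ : a.a₁₃ = l ^ 3 * a.a₁₀) : a.system.ScalesTo systemTwo := by
  obtain ⟨ξ, hξ⟩ := IsAlgClosed.exists_pow_nat_eq (a.a₁₀ * l ^ 3 / a.a₉) zero_lt_two
  have hξ' : ξ ^ 2 * a.a₉ = a.a₁₀ * l ^ 3 := by rw [hξ]; field_simp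
  have e : (C ξ ^ 2 * C a.a₉ : ScalarExpr) = C a.a₁₀ * C l ^ 3 := by
    rw [← map_pow, ← map_mul, hξ', map_mul, map_pow]
  have hξ0 : ξ ≠ 0 := by
    rintro rfl
    simp [h₁₀, hl] at hξ'
  refine ⟨a.a₁₀ * l ^ 3, ξ, l, 1, by simp [h₁₀, hl], hξ0, hl, one_ne_zero, ?_, fun k => ?_⟩
  · simp only [Coeffs.system, systemTwo, scale_add, scale_mul, scale_pow, scale_C, scale_du,
      scale_dotU]
    simp only [h₁, h₂, h₃, h₄, h₅, h₆, h₇, h₈, map_mul, map_neg, map_pow, map_ofNat, map_zero,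
      map_one]
    linear_combination 2 * C l * dotU 0 2 * e
  · simp only [Coeffs.system, systemTwo, smulU, Finsupp.add_apply, Finsupp.single_apply]
    by_cases h : 0 = k
    · subst h
      simp only [if_true, OfNat.ofNat_ne_zero, if_false, scale_add, scale_mul, scale_pow,
        scale_C, scale_zero, scale_du, scale_dotU]
      simp only [h₁₁, h₁₂, h₁₃, map_mul, map_pow, map_ofNat, map_one]
      ring
    · by_cases h' : 2 = k
      · subst h'
        simp only [h, if_true, if_false, scale_add, scale_C, scale_zero, map_mul, map_pow, map_one]
        linear_combination -e
      · simp [h, h', scale_zero]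

theorem paramsOf_four_leading {T : EvSystem} (f : ℕ → ℂ)
    (hT : T.IsHomogeneous (2 / 3) (1 / 3) (4 : ℕ)) (h : T.InvolvesOrder 4) :
    paramsOf f T 4 107 ≠ 0 ∨ paramsOf f T 4 102 ≠ 0 ∨ paramsOf f T 4 600 ≠ 0 := by
  have h1 := paramsOf_scalar (a := f) (T := T) (r := 4) (j := 7) (by norm_num)
  have h2 := paramsOf_scalar (a := f) (T := T) (r := 4) (j := 2) (by norm_num)
  have h3 := paramsOf_vector (a := f) (T := T) (r := 4) (j := 0) (k := 4) (by norm_num)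
  rw [show (allMonomials 4 (3 * 4 + 2)).getD 7 [] = [.u 4] by decide +kernel] at h1
  rw [show (allMonomials 4 (3 * 4 + 2)).getD 2 [] = [.dot 0 4] by decide +kernel] at h2
  rw [show (allMonomials 4 (3 * 4 - 3 * 4)).getD 0 [] = [] by decide +kernel] at h3
  have := hT.leading_ne_zero h
  rwa [← h1, ← h2, ← h3] at this

theorem Coeffs.IsAdmissible.scalesTo (ha : a.IsAdmissible) (h : a.system.HasSymmetry 4) :
    a.system.ScalesTo systemOne ∨ a.system.ScalesTo systemTwo := by
  obtain ⟨T, hT⟩ := h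
  have hl := paramsOf_four_leading a.toFun hT.homogeneous hT.order
  have low : ∀ i < 100, paramsOf a.toFun T 4 i = a.toFun i := fun i hi => paramsOf_low hi
  have hq := hT.scalar_equations isSmall_four checkScalar_quadraticRows
  have hv := ha.vector_coupled
  have hs := ha.scalar_coupled
  have h2 := ha.order_two
  by_cases h9 : a.a₉ = 0
  · have h1 : a.a₁ ≠ 0 := by
      have := diagonal_ne_zero hq
        (hT.scalar_equations isSmall_four checkScalar_nilpotentScalarRows)
        (hT.vector_equations isSmall_four checkVector_nilpotentVectorRows)
        (by simpa [low, toFun] using h2) (by simpa [low, toFun] using hv) hl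
      simpa [low, toFun, h9] using this
    obtain ⟨hb, z600, z10, z11, h12⟩ := nondiffusive_leading hq
      (hT.vector_equations isSmall_four checkVector_nondiffusiveLeadingRows)
      (by simpa [low, toFun] using h1) (by simpa [low, toFun] using h9)
      (by simpa [low, toFun] using hv) hl
    obtain ⟨l, z2, h3, h4, z5, z6, h7, h8, h13⟩ := nondiffusive_coeffs hq
      (hT.vector_equations isSmall_four checkVector_nondiffusiveVectorRows)
      (hT.scalar_equations isSmall_four checkScalar_nondiffusiveScalarRows)
      (by simpa [low, toFun] using h1) (by simpa [low, toFun] using h9) hb z600 z10 z11 h12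
    simp only [low, Nat.reduceLT, toFun] at z10 z11 h12 z2 h3 h4 z5 z6 h7 h8 h13
    -- For `l = 0` all of `a₃`, …, `a₈` vanish, so `U` drops out of the equation for `u`.
    have hl0 : l ≠ 0 := by
      rintro rfl
      simp [h3, h4, z5, z6, h7, h8] at hs
    exact .inl (a.scalesTo_systemOne hl0 h1 h12 z2 h3 h4 z5 z6 h7 h8 h9 z10 z11 h13)
  · obtain ⟨l, h10, z1, z2, h3, z4, h5, h6, h7, h8, h11, h12, h13⟩ := diffusive_coeffs hq
      (hT.vector_equations isSmall_four checkVector_diffusiveRows)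
      (by simpa [low, toFun] using h9) (by simpa [low, toFun] using hv) hl
    simp only [low, Nat.reduceLT, toFun] at h10 z1 z2 h3 z4 h5 h6 h7 h8 h11 h12 h13
    have hl0 : l ≠ 0 := by
      rintro rfl
      simp [h3, z4, h5, h6, h7, h8] at hs
    exact .inr (a.scalesTo_systemTwo hl0 h9 h10 z1 z2 h3 z4 h5 h6 h7 h8 h11 h12 h13)

/-! ### Absence of a symmetry of order three -/

/-- Coefficients of the vector part of the commutator with a system of weight three. -/
def thirdOrderVectorRows : List ((List Atom × ℕ) × Poly) :=
  [(([.u 0, .u 0, .u 1], 2), [⟨6, [303, 9], []⟩, ⟨-9, [500, 10], []⟩]),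
    (([.u 0, .u 0, .u 2], 1),
      [⟨-3, [303, 1], []⟩, ⟨3, [303, 9], []⟩, ⟨2, [205, 9], []⟩, ⟨-9, [500, 10], []⟩]),
    (([.u 0, .u 1, .u 2], 0), [⟨-2, [205, 1], []⟩, ⟨6, [205, 9], []⟩, ⟨-18, [500, 10], []⟩]),
    (([.u 0, .u 0, .u 3], 0),
      [⟨3, [103, 10], []⟩, ⟨-1, [205, 1], []⟩, ⟨1, [205, 9], []⟩, ⟨-3, [500, 10], []⟩])]

theorem checkVector_thirdOrderVectorRows : checkVector 3 thirdOrderVectorRows = true := by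
  decide +kernel

/-- A coefficient of the scalar part of the commutator with a system of weight three. -/
def thirdOrderScalarRows : List (List Atom × Poly) :=
  [([.dot 0 5], [⟨1, [101, 1], []⟩, ⟨-1, [101, 9], []⟩, ⟨-1, [103, 3], []⟩, ⟨1, [500, 3], []⟩])]

theorem checkScalar_thirdOrderScalarRows : checkScalar 3 thirdOrderScalarRows = true := by
  decide +kernel

theorem systemTwo_eq_system :
    systemTwo = Coeffs.system ⟨0, 0, -2, 0, -2, -6, -6, -2, 1, 1, 3, 3, 1⟩ := by
  ext1
  · simp only [systemTwo, Coeffs.system, map_zero, map_neg, map_ofNat]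
    ring
  · simp only [systemTwo, Coeffs.system, map_one, map_ofNat, one_mul]

/-- In weight three `ρ 103`, `ρ 101`, `ρ 500` multiply `∂ₓ³u`, `⟨U, ∂ₓ³U⟩`, `∂ₓ³U`. At the
coefficients of (2) the first three vector rows are independent linear equations for `ρ 303`, `ρ
205`, `ρ 500`, and the other two rows then annihilate `ρ 103` and `ρ 101`. -/
theorem not_hasSymmetry_three_systemTwo : ¬ systemTwo.HasSymmetry 3 := by
  rw [systemTwo_eq_system]
  rintro ⟨T, hT⟩
  have h1 := hT.vector_equations isSmall_three checkVector_thirdOrderVectorRows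
  have h2 := hT.scalar_equations isSmall_three checkScalar_thirdOrderScalarRows
  have h3 := hT.homogeneous.leading_ne_zero hT.order
  have low : ∀ i < 100, paramsOf _ T 3 i = _ := fun i hi =>
    paramsOf_low (a := Coeffs.toFun ⟨0, 0, -2, 0, -2, -6, -6, -2, 1, 1, 3, 3, 1⟩) hi
  generalize hρ : paramsOf (Coeffs.toFun ⟨0, 0, -2, 0, -2, -6, -6, -2, 1, 1, 3, 3, 1⟩) T 3 = ρ
    at h1 h2 low
  have p1 := paramsOf_scalar (a := Coeffs.toFun ⟨0, 0, -2, 0, -2, -6, -6, -2, 1, 1, 3, 3, 1⟩)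
    (T := T) (r := 3) (j := 3) (by norm_num)
  have p2 := paramsOf_scalar (a := Coeffs.toFun ⟨0, 0, -2, 0, -2, -6, -6, -2, 1, 1, 3, 3, 1⟩)
    (T := T) (r := 3) (j := 1) (by norm_num)
  have p3 := paramsOf_vector (a := Coeffs.toFun ⟨0, 0, -2, 0, -2, -6, -6, -2, 1, 1, 3, 3, 1⟩)
    (T := T) (r := 3) (j := 0) (k := 3) (by norm_num)
  rw [show (allMonomials 3 (3 * 3 + 2)).getD 3 [] = [.u 3] by decide +kernel, hρ] at p1
  rw [show (allMonomials 3 (3 * 3 + 2)).getD 1 [] = [.dot 0 3] by decide +kernel, hρ] at p2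
  rw [show (allMonomials 3 (3 * 3 - 3 * 3)).getD 0 [] = [] by decide +kernel, hρ] at p3
  rw [← p1, ← p2, ← p3] at h3
  simp only [thirdOrderVectorRows, thirdOrderScalarRows, List.forall_mem_cons, Poly.total,
    Term.const, List.map_cons, List.map_nil, List.sum_cons, List.sum_nil, List.prod_cons,
    List.prod_nil, Int.cast_neg, Int.cast_one, Int.cast_ofNat, low, Nat.reduceLT, Coeffs.toFun]
    at h1 h2
  obtain ⟨e1, e2, e3, e4, -⟩ := h1
  obtain ⟨e5, -⟩ := h2
  -- The combination cancels `ρ 303` and `ρ 205`.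
  have z3 : ρ 500 = 0 := by linear_combination 2 / 3 * e2 - e1 / 3 - 2 / 9 * e3
  have q : ρ 205 = 0 := by linear_combination e3 / 6 + 3 * z3
  have u3 : ρ 103 = 0 := by linear_combination e4 / 3 - q / 3 + z3
  have d3 : ρ 101 = 0 := by linear_combination -e5 + 2 * u3 - 2 * z3
  simp [z3, u3, d3] at h3

/-! ### Symmetries of order four -/

section Derivations

variable {N : ℕ} (F : Option (Fin N) → DiffPoly N)

/-- The commutator of the two derivations is a derivation that vanishes on every variable. -/
theorem Dt_Dx (p : DiffPoly N) : Dt F (Dx N p) = Dx N (Dt F p) := by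
  have : ⁅Dt F, Dx N⁆ = 0 := by
    refine derivation_ext fun v => ?_
    rw [Derivation.commutator_apply, Dx_X, Dt_X, Dt_X, Function.iterate_succ_apply', sub_self]
    rfl
  rw [← sub_eq_zero, ← Derivation.commutator_apply, this, Derivation.zero_apply]

theorem Dt_X_zero (w : Option (Fin N)) : Dt F (X (w, 0)) = F w := Dt_X F _

variable (N) in
/-- `⟨U, U⟩` in components. -/
noncomputable def normSq : DiffPoly N := ∑ j : Fin N, X (some j, 0) * X (some j, 0)

variable (N) in
/-- `u + ⟨U, U⟩` in components. -/
noncomputable def shifted : DiffPoly N := X (none, 0) + normSq N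

theorem Dt_normSq : Dt F (normSq N) = 2 * ∑ j : Fin N, X (some j, 0) * F (some j) := by
  simp only [normSq, map_sum, Derivation.leibniz, Dt_X_zero, smul_eq_mul, Finset.mul_sum]
  exact Finset.sum_congr rfl fun j _ => by ring

theorem Dt_shifted : Dt F (shifted N) = F none + Dt F (normSq N) := by
  rw [shifted, map_add, Dt_X_zero]

theorem toComponents_du (m : ℕ) : ScalarExpr.toComponents N (du m) = X (none, m) := by
  simp [ScalarExpr.toComponents, du, Factor.toComponents]

theorem toComponents_dotU (m n : ℕ) : ScalarExpr.toComponents N (dotU m n) =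
    ∑ j : Fin N, X (some j, m) * X (some j, n) := by
  simp [ScalarExpr.toComponents, dotU, Factor.toComponents, dotComponents_mk]

theorem toComponents_add (P Q : ScalarExpr) : ScalarExpr.toComponents N (P + Q) =
    ScalarExpr.toComponents N P + ScalarExpr.toComponents N Q := map_add _ _ _

theorem toComponents_sub (P Q : ScalarExpr) : ScalarExpr.toComponents N (P - Q) =
    ScalarExpr.toComponents N P - ScalarExpr.toComponents N Q := map_sub _ _ _

theorem toComponents_neg (P : ScalarExpr) : ScalarExpr.toComponents N (-P) =
    -ScalarExpr.toComponents N P := map_neg _ _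

theorem toComponents_mul (P Q : ScalarExpr) : ScalarExpr.toComponents N (P * Q) =
    ScalarExpr.toComponents N P * ScalarExpr.toComponents N Q := map_mul _ _ _

theorem toComponents_pow (P : ScalarExpr) (n : ℕ) : ScalarExpr.toComponents N (P ^ n) =
    ScalarExpr.toComponents N P ^ n := map_pow _ _ _

theorem toComponents_one : ScalarExpr.toComponents N 1 = 1 := map_one _

theorem toComponents_ofNat (n : ℕ) [n.AtLeastTwo] :
    ScalarExpr.toComponents N ofNat(n) = ofNat(n) := map_ofNat _ n

theorem sum_smulU (P : ScalarExpr) (k : ℕ) (j : Fin N) :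
    (smulU P k).sum (fun k P => ScalarExpr.toComponents N P * X (some j, k)) =
      ScalarExpr.toComponents N P * X (some j, k) :=
  Finsupp.sum_single_index (by simp [ScalarExpr.toComponents])

theorem sum_vector_add (f g : VectorExpr) (j : Fin N) :
    (f + g).sum (fun k P => ScalarExpr.toComponents N P * X (some j, k)) =
      f.sum (fun k P => ScalarExpr.toComponents N P * X (some j, k)) +
        g.sum (fun k P => ScalarExpr.toComponents N P * X (some j, k)) :=
  Finsupp.sum_add_index' (fun _ => by simp [ScalarExpr.toComponents]) fun _ _ _ => by
    rw [toComponents_add, add_mul]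

end Derivations

/-- `w = u + ⟨U, U⟩`. -/
noncomputable def shift₀ : ScalarExpr := du 0 + dotU 0 0

/-- The `x`-derivative of `w`. -/
noncomputable def shift₁ : ScalarExpr := du 1 + 2 * dotU 0 1

/-- The second `x`-derivative of `w`. -/
noncomputable def shift₂ : ScalarExpr := du 2 + 2 * dotU 0 2 + 2 * dotU 1 1

/-- The fourth `x`-derivative of `w`. -/
noncomputable def shift₄ : ScalarExpr := du 4 + 2 * dotU 0 4 + 8 * dotU 1 3 + 6 * dotU 2 2

section Derivations

variable {N : ℕ}

theorem toComponents_shift₀ : ScalarExpr.toComponents N shift₀ = shifted N := by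
  rw [shift₀, toComponents_add, toComponents_du, toComponents_dotU, shifted, normSq]

theorem Dx_toComponents_du (m : ℕ) : Dx N (ScalarExpr.toComponents N (du m)) =
    ScalarExpr.toComponents N (du (m + 1)) := by
  rw [toComponents_du, toComponents_du, Dx_X]

theorem Dx_toComponents_dotU (m n : ℕ) : Dx N (ScalarExpr.toComponents N (dotU m n)) =
    ScalarExpr.toComponents N (dotU m (n + 1)) + ScalarExpr.toComponents N (dotU n (m + 1)) := by
  simp only [toComponents_dotU, map_sum, Derivation.leibniz, Dx_X, smul_eq_mul,
    Finset.sum_add_distrib]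

theorem dotU_comm (m n : ℕ) : dotU m n = dotU n m := by rw [dotU, dotU, Sym2.eq_swap]

theorem derivation_ofNat {R : Type*} [CommRing R] [Algebra ℂ R] (d : Derivation ℂ R R) (n : ℕ)
    [n.AtLeastTwo] : d ofNat(n) = 0 := d.map_natCast n

theorem toComponents_shift₁ : ScalarExpr.toComponents N shift₁ = Dx N (shifted N) := by
  rw [← toComponents_shift₀]
  simp only [shift₀, shift₁, toComponents_add, toComponents_mul, toComponents_ofNat, map_add,
    Dx_toComponents_du, Dx_toComponents_dotU]
  ring

theorem toComponents_shift₂ : ScalarExpr.toComponents N shift₂ = Dx N (Dx N (shifted N)) := by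
  rw [← toComponents_shift₁]
  simp only [shift₁, shift₂, toComponents_add, toComponents_mul, toComponents_ofNat, map_add,
    Derivation.leibniz, derivation_ofNat, smul_eq_mul, Dx_toComponents_du, Dx_toComponents_dotU]
  ring

theorem toComponents_shift₄ :
    ScalarExpr.toComponents N shift₄ = Dx N (Dx N (Dx N (Dx N (shifted N)))) := by
  rw [← toComponents_shift₂]
  simp only [shift₂, shift₄, toComponents_add, toComponents_mul, toComponents_ofNat, map_add,
    Derivation.leibniz, derivation_ofNat, smul_eq_mul, Dx_toComponents_du, Dx_toComponents_dotU,
    map_zero, Nat.reduceAdd, dotU_comm 2 1, dotU_comm 3 1]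
  ring

end Derivations

/-! #### The first system -/

/-- The symmetry of order four of `systemOne`. -/
noncomputable def symmetryOne : EvSystem where
  scalar := shift₄ + 2 * dotU 0 0 ^ 3 * shift₂
  vector := smulU (-(dotU 0 0 ^ 2 * shift₂)) 0

/-- The symmetry of order four of `systemTwo`. -/
noncomputable def symmetryTwo : EvSystem where
  scalar := -2 * (dotU 0 4 + 2 * shift₀ ^ 3 * dotU 0 2 + 6 * shift₀ ^ 2 * shift₁ * dotU 0 1
    + (3 * shift₀ ^ 2 * shift₂ + 6 * shift₀ * shift₁ ^ 2 + shift₀ ^ 6) * dotU 0 0)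
  vector := smulU 1 4 + smulU (2 * shift₀ ^ 3) 2 + smulU (6 * shift₀ ^ 2 * shift₁) 1
    + smulU (3 * shift₀ ^ 2 * shift₂ + 6 * shift₀ * shift₁ ^ 2 + shift₀ ^ 6) 0

section Commutation

variable (N : ℕ)

theorem toComponents_dotU_zero : ScalarExpr.toComponents N (dotU 0 0) = normSq N :=
  toComponents_dotU 0 0

theorem rhs_systemOne_some (j : Fin N) : systemOne.rhs N (some j) =
    -(shifted N * normSq N ^ 2) * X (some j, 0) := by
  simp only [EvSystem.rhs, systemOne, sum_smulU, toComponents_sub, toComponents_neg,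
    toComponents_mul, toComponents_pow, toComponents_du, toComponents_dotU_zero, shifted]
  ring

theorem Dt_normSq_of_eq_mul {F : Option (Fin N) → DiffPoly N} {p : DiffPoly N}
    (h : ∀ j, F (some j) = p * X (some j, 0)) : Dt F (normSq N) = 2 * p * normSq N := by
  rw [Dt_normSq, normSq, Finset.mul_sum, Finset.mul_sum]
  exact Finset.sum_congr rfl fun j _ => by rw [h]; ring

/-- Adding `⟨U, U⟩_t = -2w⟨U, U⟩³` to this expression leaves the linear equation `w_t = w_xx`. -/
theorem rhs_systemOne_none : systemOne.rhs N none =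
    Dx N (Dx N (shifted N)) + 2 * shifted N * normSq N ^ 3 := by
  have : systemOne.scalar = shift₂ + 2 * shift₀ * dotU 0 0 ^ 3 := by
    rw [systemOne, shift₂, shift₀]; ring
  simp only [EvSystem.rhs, this, toComponents_add, toComponents_mul, toComponents_pow,
    toComponents_ofNat, toComponents_dotU_zero, toComponents_shift₂, toComponents_shift₀]

theorem rhs_symmetryOne_some (j : Fin N) : symmetryOne.rhs N (some j) =
    -(normSq N ^ 2 * Dx N (Dx N (shifted N))) * X (some j, 0) := by
  simp only [EvSystem.rhs, symmetryOne, sum_smulU, toComponents_neg,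
    toComponents_mul, toComponents_pow, toComponents_shift₂, toComponents_dotU_zero]

theorem rhs_symmetryOne_none : symmetryOne.rhs N none =
    Dx N (Dx N (Dx N (Dx N (shifted N)))) + 2 * normSq N ^ 3 * Dx N (Dx N (shifted N)) := by
  simp only [EvSystem.rhs, symmetryOne, toComponents_add, toComponents_mul, toComponents_pow,
    toComponents_ofNat, toComponents_dotU_zero, toComponents_shift₂, toComponents_shift₄]

/-- With `v = ⟨U, U⟩` the flows read `w_t = w_xx`, `v_t = -2wv³` and `w_τ = w_xxxx`, `v_τ = -2w_xx
v³`. Everything is thus expressed through `w`, `v` and `U`, and cross-differentiation becomes a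
polynomial identity. -/
theorem systemOne_commutesWith_symmetryOne : systemOne.CommutesWith symmetryOne N := by
  have v1 := Dt_normSq_of_eq_mul N (rhs_systemOne_some N)
  have v2 := Dt_normSq_of_eq_mul N (rhs_symmetryOne_some N)
  have w1 := Dt_shifted (systemOne.rhs N)
  rw [v1, rhs_systemOne_none] at w1
  replace w1 : Dt (systemOne.rhs N) (shifted N) = Dx N (Dx N (shifted N)) := by rw [w1]; ring
  have w2 := Dt_shifted (symmetryOne.rhs N)
  rw [v2, rhs_symmetryOne_none] at w2
  replace w2 : Dt (symmetryOne.rhs N) (shifted N) = Dx N (Dx N (Dx N (Dx N (shifted N)))) := by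
    rw [w2]; ring
  rintro (_ | j)
  · rw [rhs_systemOne_none, rhs_symmetryOne_none]
    simp only [map_add, Derivation.leibniz, Derivation.leibniz_pow, Dt_Dx, v1, v2, w1, w2,
      derivation_ofNat,
      smul_eq_mul, nsmul_eq_mul]
    push_cast
    ring
  · rw [rhs_systemOne_some, rhs_symmetryOne_some]
    simp only [map_neg, Derivation.leibniz, Derivation.leibniz_pow, Dt_Dx, Dt_X_zero, v1, v2, w1,
      w2, smul_eq_mul, nsmul_eq_mul, rhs_systemOne_some, rhs_symmetryOne_some]
    push_cast
    ring

/-! ### The second system: a linear operator with conserved potential. -/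

/-- The operator `∂ₓ² + w³`. -/
noncomputable def schrodinger (p : DiffPoly N) : DiffPoly N :=
  Dx N (Dx N p) + shifted N ^ 3 * p

-- The only coefficient of the operator is `w³`, which is constant along the flow.
variable {N} in
theorem Dt_schrodinger {F : Option (Fin N) → DiffPoly N} (h : Dt F (shifted N) = 0)
    (p : DiffPoly N) : Dt F (schrodinger N p) = schrodinger N (Dt F p) := by
  simp only [schrodinger, map_add, Derivation.leibniz, Derivation.leibniz_pow, Dt_Dx, h,
    smul_eq_mul, mul_zero, smul_zero, add_zero]

theorem rhs_systemTwo_some (j : Fin N) :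
    systemTwo.rhs N (some j) = schrodinger N (X (some j, 0)) := by
  have : systemTwo.vector = smulU 1 2 + smulU (shift₀ ^ 3) 0 := by
    simp only [systemTwo, shift₀]
    congr 2
    ring
  simp only [EvSystem.rhs, this, sum_vector_add, sum_smulU, toComponents_pow, toComponents_one,
    toComponents_shift₀, schrodinger, Dx_X, one_mul]

/-- This form shows `u_t = -⟨U, U⟩_t`, which is the conservation of `w`. -/
theorem rhs_systemTwo_none :
    systemTwo.rhs N none = -2 * ∑ j : Fin N, X (some j, 0) * systemTwo.rhs N (some j) := by
  have : systemTwo.scalar = -(2 * (dotU 0 2 + shift₀ ^ 3 * dotU 0 0)) := by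
    rw [systemTwo, shift₀]
    ring
  simp only [rhs_systemTwo_some, schrodinger, Dx_X]
  simp only [EvSystem.rhs, this, toComponents_neg, toComponents_mul, toComponents_add,
    toComponents_pow, toComponents_ofNat, toComponents_shift₀, toComponents_dotU, Finset.mul_sum,
    ← Finset.sum_add_distrib, ← Finset.sum_neg_distrib]
  exact Finset.sum_congr rfl fun j _ => by ring

theorem rhs_symmetryTwo_some (j : Fin N) :
    symmetryTwo.rhs N (some j) = schrodinger N (schrodinger N (X (some j, 0))) := by
  simp only [EvSystem.rhs, symmetryTwo, sum_vector_add, sum_smulU, toComponents_pow,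
    toComponents_one, toComponents_add, toComponents_mul, toComponents_ofNat,
    toComponents_shift₀, toComponents_shift₁, toComponents_shift₂, schrodinger, map_add,
    Derivation.leibniz, Derivation.leibniz_pow, Dx_X, smul_eq_mul, nsmul_eq_mul,
    Derivation.map_natCast]
  push_cast
  ring

theorem rhs_symmetryTwo_none :
    symmetryTwo.rhs N none = -2 * ∑ j : Fin N, X (some j, 0) * symmetryTwo.rhs N (some j) := by
  simp only [EvSystem.rhs, symmetryTwo, sum_vector_add, sum_smulU, toComponents_pow,
    toComponents_one, toComponents_add, toComponents_mul, toComponents_neg, toComponents_ofNat,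
    toComponents_dotU, Finset.mul_sum, ← Finset.sum_add_distrib]
  exact Finset.sum_congr rfl fun j _ => by ring

/-- Both flows preserve `w`, so `L` passes through both time derivatives and both mixed derivatives
of `U` equal `L³U`. The scalar equation follows from `u_t = -2⟨U, U_t⟩` and its analogue for `τ`. -/
theorem systemTwo_commutesWith_symmetryTwo : systemTwo.CommutesWith symmetryTwo N := by
  have w1 : Dt (systemTwo.rhs N) (shifted N) = 0 := by
    rw [Dt_shifted, Dt_normSq, rhs_systemTwo_none]
    ring
  have w2 : Dt (symmetryTwo.rhs N) (shifted N) = 0 := by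
    rw [Dt_shifted, Dt_normSq, rhs_symmetryTwo_none]
    ring
  have hs : ∀ j : Fin N, Dt (symmetryTwo.rhs N) (systemTwo.rhs N (some j)) =
      Dt (systemTwo.rhs N) (symmetryTwo.rhs N (some j)) := fun j => by
    rw [rhs_systemTwo_some, rhs_symmetryTwo_some, Dt_schrodinger w2, Dt_schrodinger w1,
      Dt_schrodinger w1, Dt_X_zero, Dt_X_zero, rhs_systemTwo_some, rhs_symmetryTwo_some]
  rintro (_ | j)
  · rw [rhs_systemTwo_none, rhs_symmetryTwo_none]
    have two : ∀ (d : Derivation ℂ (DiffPoly N) (DiffPoly N)) (p : DiffPoly N),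
        d (-2 * p) = -2 * d p := fun d p => by
      rw [Derivation.leibniz, map_neg, derivation_ofNat, neg_zero, smul_zero, add_zero, smul_eq_mul]
    rw [two, two, map_sum, map_sum]
    refine congrArg _ (Finset.sum_congr rfl fun j _ => ?_)
    rw [Derivation.leibniz, Derivation.leibniz, Dt_X_zero, Dt_X_zero, hs j, smul_eq_mul,
      smul_eq_mul, smul_eq_mul, mul_comm (systemTwo.rhs N (some j))]
  · exact hs j

end Commutation

/-! ### Weights of the two symmetries. -/

/-- Homogeneity in the weighting `(2/3, 1/3)`. -/
abbrev HasWeight (P : ScalarExpr) (w : ℚ) : Prop :=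
  IsWeightedHomogeneous (Factor.weight (2 / 3) (1 / 3)) P w

section Homogeneity

theorem HasWeight.of_eq {P : ScalarExpr} {v w : ℚ} (h : HasWeight P v) (e : v = w) :
    HasWeight P w := e ▸ h

theorem hasWeight_du (m : ℕ) : HasWeight (du m) (2 / 3 + m) := isWeightedHomogeneous_X ℂ _ _

theorem hasWeight_dotU (m n : ℕ) : HasWeight (dotU m n) (2 / 3 + m + n) := by
  refine HasWeight.of_eq (isWeightedHomogeneous_X ℂ _ _) ?_
  rw [Factor.weight, Sym2.lift_mk]
  ring

theorem HasWeight.ofNat_mul {P : ScalarExpr} {w : ℚ} (h : HasWeight P w) (n : ℕ)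
    [n.AtLeastTwo] : HasWeight (ofNat(n) * P) w := by
  rw [← map_ofNat C]
  exact h.C_mul _

theorem HasWeight.power {P : ScalarExpr} {w : ℚ} (h : HasWeight P w) (n : ℕ) :
    HasWeight (P ^ n) (n * w) := by
  rw [← nsmul_eq_mul]
  exact h.pow n

theorem hasWeight_shift₀ : HasWeight shift₀ (2 / 3) :=
  ((hasWeight_du 0).of_eq (by norm_num)).add ((hasWeight_dotU 0 0).of_eq (by norm_num))

theorem hasWeight_shift₁ : HasWeight shift₁ (5 / 3) :=
  ((hasWeight_du 1).of_eq (by norm_num)).add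
    (((hasWeight_dotU 0 1).of_eq (by norm_num)).ofNat_mul 2)

theorem hasWeight_shift₂ : HasWeight shift₂ (8 / 3) :=
  (((hasWeight_du 2).of_eq (by norm_num)).add
    (((hasWeight_dotU 0 2).of_eq (by norm_num)).ofNat_mul 2)).add
    (((hasWeight_dotU 1 1).of_eq (by norm_num)).ofNat_mul 2)

theorem hasWeight_shift₄ : HasWeight shift₄ (14 / 3) :=
  ((((hasWeight_du 4).of_eq (by norm_num)).add
    (((hasWeight_dotU 0 4).of_eq (by norm_num)).ofNat_mul 2)).add
    (((hasWeight_dotU 1 3).of_eq (by norm_num)).ofNat_mul 8)).add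
    (((hasWeight_dotU 2 2).of_eq (by norm_num)).ofNat_mul 6)

theorem hasWeight_normSq : HasWeight (dotU 0 0) (2 / 3) :=
  (hasWeight_dotU 0 0).of_eq (by norm_num)

theorem hasWeight_smulU {P : ScalarExpr} {w : ℚ} {i : ℕ} (h : HasWeight P (w - i)) (k : ℕ) :
    HasWeight (smulU P i k) (w - k) := by
  rw [smulU, Finsupp.single_apply]
  split_ifs with e
  · exact e ▸ h
  · exact isWeightedHomogeneous_zero _ _ _

theorem isHomogeneous_symmetryOne : symmetryOne.IsHomogeneous (2 / 3) (1 / 3) (4 : ℕ) := by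
  refine ⟨HasWeight.of_eq (hasWeight_shift₄.add ?_) (by norm_num), hasWeight_smulU (.neg ?_)⟩
  · exact HasWeight.of_eq (((hasWeight_normSq.power 3).ofNat_mul 2).mul hasWeight_shift₂)
      (by norm_num)
  · exact HasWeight.of_eq ((hasWeight_normSq.power 2).mul hasWeight_shift₂) (by norm_num)

theorem isHomogeneous_symmetryTwo : symmetryTwo.IsHomogeneous (2 / 3) (1 / 3) (4 : ℕ) := by
  have h3 : HasWeight (2 * shift₀ ^ 3) 2 :=
    HasWeight.of_eq ((hasWeight_shift₀.power 3).ofNat_mul 2) (by norm_num)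
  have h2 : HasWeight (6 * shift₀ ^ 2 * shift₁) 3 :=
    HasWeight.of_eq (((hasWeight_shift₀.power 2).ofNat_mul 6).mul hasWeight_shift₁) (by norm_num)
  have h1 : HasWeight (3 * shift₀ ^ 2 * shift₂ + 6 * shift₀ * shift₁ ^ 2 + shift₀ ^ 6) 4 :=
    ((HasWeight.of_eq (((hasWeight_shift₀.power 2).ofNat_mul 3).mul hasWeight_shift₂)
      (by norm_num)).add (HasWeight.of_eq ((hasWeight_shift₀.ofNat_mul 6).mul
        (hasWeight_shift₁.power 2)) (by norm_num))).add
      (HasWeight.of_eq (hasWeight_shift₀.power 6) (by norm_num))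
  constructor
  · rw [symmetryTwo, neg_mul]
    refine IsWeightedHomogeneous.neg (HasWeight.ofNat_mul ?_ 2)
    refine IsWeightedHomogeneous.add (IsWeightedHomogeneous.add (IsWeightedHomogeneous.add
      ?_ ?_) ?_) ?_
    · exact HasWeight.of_eq (hasWeight_dotU 0 4) (by norm_num)
    · exact HasWeight.of_eq (h3.mul (hasWeight_dotU 0 2)) (by norm_num)
    · exact HasWeight.of_eq (h2.mul (hasWeight_dotU 0 1)) (by norm_num)
    · exact HasWeight.of_eq (h1.mul (hasWeight_dotU 0 0)) (by norm_num)
  · intro k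
    refine IsWeightedHomogeneous.add (IsWeightedHomogeneous.add (IsWeightedHomogeneous.add
      (hasWeight_smulU ?_ k) (hasWeight_smulU ?_ k)) (hasWeight_smulU ?_ k)) (hasWeight_smulU ?_ k)
    · exact HasWeight.of_eq (isWeightedHomogeneous_one ℂ _) (by norm_num)
    · exact h3.of_eq (by norm_num)
    · exact h2.of_eq (by norm_num)
    · exact h1.of_eq (by norm_num)

end Homogeneity

/-- The partial derivative of the scalar part by `∂ₓ⁴u` is `1`; this shows at once that the order is
attained and that the scalar part is non-zero. -/
theorem hasSymmetry_four_systemOne : systemOne.HasSymmetry 4 := by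
  have h4 : pderiv (Factor.u 4) symmetryOne.scalar = 1 := by
    simp [symmetryOne, shift₄, shift₂, du, dotU, pderiv_X, derivation_ofNat]
  have h2 : pderiv (Factor.u 2) shift₂ = 1 := by
    simp [shift₂, du, dotU, pderiv_X, derivation_ofNat]
  refine ⟨symmetryOne, isHomogeneous_symmetryOne, .inl ⟨.u 4, ?_, rfl⟩, ?_, ?_,
    fun N _ => systemOne_commutesWith_symmetryOne N⟩
  · by_contra h
    rw [pderiv_eq_zero_of_notMem_vars h] at h4
    exact zero_ne_one h4
  · intro h
    rw [h, map_zero] at h4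
    exact zero_ne_one h4
  · refine Finsupp.single_ne_zero.2 (neg_ne_zero.2 (mul_ne_zero (pow_ne_zero _ (X_ne_zero _)) ?_))
    intro h
    rw [h, map_zero] at h2
    exact zero_ne_one h2

theorem hasSymmetry_four_systemTwo : systemTwo.HasSymmetry 4 := by
  have h4 : symmetryTwo.vector 4 = 1 := by
    simp [symmetryTwo, smulU]
  have h4' : pderiv (Factor.dot s(0, 4)) symmetryTwo.scalar = -2 := by
    simp [symmetryTwo, shift₀, shift₁, shift₂, du, dotU, pderiv_X, derivation_ofNat]
  refine ⟨symmetryTwo, isHomogeneous_symmetryTwo, .inr (.inl ?_), ?_, ?_,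
    fun N _ => systemTwo_commutesWith_symmetryTwo N⟩
  · rw [h4]
    exact one_ne_zero
  · intro h
    rw [h, map_zero] at h4'
    simp at h4'
  · intro h
    rw [h] at h4
    exact zero_ne_one h4

end VectorEvolution

theorem mainTheorem7 :
    (∀ a : VectorEvolution.Coeffs, a.IsAdmissible → a.system.HasSymmetry 4 →
      a.system.ScalesTo VectorEvolution.systemOne ∨ a.system.ScalesTo VectorEvolution.systemTwo) ∧
    VectorEvolution.systemOne.HasSymmetry 4 ∧
    VectorEvolution.systemTwo.HasSymmetry 4 ∧
    ¬ VectorEvolution.systemTwo.HasSymmetry 3 :=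
  ⟨fun _ ha h => ha.scalesTo h, VectorEvolution.hasSymmetry_four_systemOne,
    VectorEvolution.hasSymmetry_four_systemTwo, VectorEvolution.not_hasSymmetry_three_systemTwo⟩
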